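/- Let $q$ be a prime power, $G=\mathrm{SL}_2(\mathbb F_q)$, and let $G$ act on $\mathbb F_q[X,Y]$ by the algebra automorphisms $\begin{pmatrix}a&b\\c&d\end{pmatrix}\cdot X^iY^j=(aX+cY)^i(bX+dY)^j$. The Steinberg module $\overline{\mathrm{st}}$ is the $G$-stable $\mathbb F_q$-span of the monomials $X^iY^{q-1-i}$, $0\le i\le q-1$, with $\binom{q-1}{i}\ne 0$ in $\mathbb F_q$. Let $\kappa$ be a finite extension of $\mathbb F_q$ of even degree (so $\kappa\supseteq\mathbb F_{q^2}$), let $\alpha$ be a generator of $\kappa^\times$, let $\xi\in\mathbb C^\times$ be a root of unity of exact order $\#\kappa^\times$, and let $\chi:\kappa\to\mathbb C$ be the homomorphism of multiplicative monoids with $\chi(\alpha)=\xi$ and $\chi(0)=0$. For a finite-dimensional $\mathbb F_q[G]$-module $\overline V$ and $g\in G$ of order prime to the characteristic of $\mathbb F_q$, let $\psi_{\overline V}(g)=\sum_i\chi(\lambda_i)$, where the $\lambda_i\in\kappa$ are the eigenvalues of $g$ on $\overline V\otimes_{\mathbb F_q}\kappa$, counted with algebraic multiplicity (the Brauer character of $\overline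 V$). For $n\in\{q-1,q+1\}$ let $\mu_n=\{\zeta\in\kappa^\times:\zeta^n=1\}$, and for $\zeta\in\mu_{q-1}\cup\mu_{q+1}$ let $A_\zeta\in G$ be $\pm I_2$ if $\zeta=\pm1$, and $A_\zeta=\begin{pmatrix}0&-1\\1&\zeta+\zeta^{-1}\end{pmatrix}$ otherwise (note that $\zeta+\zeta^{-1}\in\mathbb F_q$). Theorem. For every finite-dimensional $\mathbb F_q[G]$-module $\overline V$, $$\dim_{\mathbb F_q}\mathrm{Hom}_{\mathbb F_q[G]}(\overline{\mathrm{st}},\overline V)=\frac12\Big(\frac1{q-1}\sum_{\zeta\in\mu_{q-1}}\psi_{\overline V}(A_\zeta)-\frac1{q+1}\sum_{\zeta\in\mu_{q+1}}\psi_{\overline V}(A_\zeta)\Big).$$ -/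

import Mathlib

noncomputable section

namespace SLTwo

open Matrix

/-- The action of `SL₂(F)` on `F[X, Y]` (with `X = X 0`, `Y = X 1`) by linear substitutions:
`(a, b; c, d) • (X ^ i * Y ^ j) = (a X + c Y) ^ i * (b X + d Y) ^ j`. -/
def polyRep (F : Type*) [Field F] :
    Representation F (SpecialLinearGroup (Fin 2) F) (MvPolynomial (Fin 2) F) where
  toFun g := (MvPolynomial.aeval (R := F) (fun j : Fin 2 =>
    g.1 0 j • (MvPolynomial.X 0 : MvPolynomial (Fin 2) F) + g.1 1 j • MvPolynomial.X 1)).toLinearMap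
  map_one' := by
    have h : (MvPolynomial.aeval (R := F) (fun j : Fin 2 =>
        (1 : SpecialLinearGroup (Fin 2) F).1 0 j • (MvPolynomial.X 0 : MvPolynomial (Fin 2) F)
          + (1 : SpecialLinearGroup (Fin 2) F).1 1 j • MvPolynomial.X 1)) = AlgHom.id F _ := by
      apply MvPolynomial.algHom_ext
      intro j
      fin_cases j <;> simp
    rw [h]
    rfl
  map_mul' g h := by
    rw [Module.End.mul_eq_comp, ← AlgHom.comp_toLinearMap]
    congr 1
    apply MvPolynomial.algHom_ext
    intro j
    have hm : ∀ i, (g * h).1 i j = g.1 i 0 * h.1 0 j + g.1 i 1 * h.1 1 j := fun i => by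
      change (g.1 * h.1) i j = _
      rw [Matrix.mul_apply, Fin.sum_univ_two]
    simp only [MvPolynomial.aeval_X, AlgHom.comp_apply, map_add, map_smul, hm]
    module

/-- The `F`-span of the monomials `X ^ i * Y ^ (k - i)`, `0 ≤ i ≤ k`, such that the binomial
coefficient `k.choose i` is non-zero in `F`. -/
def simpleSubmodule (F : Type*) [Field F] (k : ℕ) : Submodule F (MvPolynomial (Fin 2) F) :=
  Submodule.span F
    {f | ∃ i : ℕ, i ≤ k ∧ ((k.choose i : ℕ) : F) ≠ 0 ∧
      f = MvPolynomial.X 0 ^ i * MvPolynomial.X 1 ^ (k - i)}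

theorem choose_smul_mem (F : Type*) [Field F] (k j : ℕ) (hj : j ≤ k) :
    ((k.choose j : ℕ) : F) • (MvPolynomial.X 0 ^ j * MvPolynomial.X 1 ^ (k - j) :
      MvPolynomial (Fin 2) F) ∈ simpleSubmodule F k := by
  by_cases h : ((k.choose j : ℕ) : F) = 0
  · rw [h, zero_smul]
    exact Submodule.zero_mem _
  · exact Submodule.smul_mem _ _ (Submodule.subset_span ⟨j, hj, h, rfl⟩)

theorem coeff_linear_pow {R : Type*} [CommRing R] (u v : R) (k i : ℕ) (hi : i ≤ k) :
    ((Polynomial.C u * Polynomial.X + Polynomial.C v) ^ k).coeff i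
      = u ^ i * v ^ (k - i) * (k.choose i : ℕ) := by
  have h : (Polynomial.C u * Polynomial.X + Polynomial.C v) ^ k
      = ∑ m ∈ Finset.range (k + 1),
        Polynomial.C (u ^ m * v ^ (k - m) * (k.choose m : ℕ)) * Polynomial.X ^ m := by
    rw [add_pow]
    refine Finset.sum_congr rfl fun m _ => ?_
    simp only [map_mul, map_pow, map_natCast]
    ring
  rw [h, Polynomial.finsetSum_coeff]
  simp only [Polynomial.coeff_C_mul_X_pow]
  rw [Finset.sum_ite_eq, if_pos (Finset.mem_range.2 (by omega))]

theorem polyRep_mem_simpleSubmodule {F : Type*} [Field F] (k : ℕ)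
    (g : SpecialLinearGroup (Fin 2) F) ⦃f : MvPolynomial (Fin 2) F⦄
    (hf : f ∈ simpleSubmodule F k) : polyRep F g f ∈ simpleSubmodule F k := by
  suffices h : simpleSubmodule F k ≤ (simpleSubmodule F k).comap (polyRep F g) from h hf
  refine Submodule.span_le.2 ?_
  rintro _ ⟨i, hi, hne, rfl⟩
  let x : MvPolynomial (Fin 2) F := MvPolynomial.X 0
  let y : MvPolynomial (Fin 2) F := MvPolynomial.X 1
  let u : MvPolynomial (Fin 2) F := g.1 0 0 • x + g.1 1 0 • y
  let v : MvPolynomial (Fin 2) F := g.1 0 1 • x + g.1 1 1 • y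
  have hg : polyRep F g (x ^ i * y ^ (k - i)) = u ^ i * v ^ (k - i) := by
    change MvPolynomial.aeval _ _ = _
    simp [x, y, u, v]
  let s : ℕ → Polynomial F := fun j =>
    (Polynomial.C (g.1 0 0) * Polynomial.X + Polynomial.C (g.1 0 1)) ^ j
      * (Polynomial.C (g.1 1 0) * Polynomial.X + Polynomial.C (g.1 1 1)) ^ (k - j)
  have key : (Polynomial.C u * Polynomial.X + Polynomial.C v) ^ k
      = ∑ j ∈ Finset.range (k + 1), Polynomial.C ((k.choose j : ℕ) * (x ^ j * y ^ (k - j)))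
          * (s j).map (MvPolynomial.C : F →+* MvPolynomial (Fin 2) F) := by
    have h1 : Polynomial.C u * Polynomial.X + Polynomial.C v
        = Polynomial.C x * (Polynomial.C (MvPolynomial.C (g.1 0 0)) * Polynomial.X
            + Polynomial.C (MvPolynomial.C (g.1 0 1)))
          + Polynomial.C y * (Polynomial.C (MvPolynomial.C (g.1 1 0)) * Polynomial.X
            + Polynomial.C (MvPolynomial.C (g.1 1 1))) := by
      simp only [u, v, MvPolynomial.smul_eq_C_mul, map_add, map_mul]
      ring
    simp only [h1, add_pow (Polynomial.C x * _), mul_pow]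
    refine Finset.sum_congr rfl fun m _ => ?_
    simp only [s, Polynomial.map_mul, Polynomial.map_pow, Polynomial.map_add, Polynomial.map_C,
      Polynomial.map_X, map_mul, map_pow, map_natCast]
    ring
  have hc := congrArg (fun P => Polynomial.coeff P i) key
  simp only [coeff_linear_pow u v k i hi, Polynomial.finsetSum_coeff, Polynomial.coeff_C_mul,
    Polynomial.coeff_map] at hc
  have hmem : ((k.choose i : ℕ) : F) • (u ^ i * v ^ (k - i)) ∈ simpleSubmodule F k := by
    have h2 : ((k.choose i : ℕ) : F) • (u ^ i * v ^ (k - i))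
        = u ^ i * v ^ (k - i) * ((k.choose i : ℕ) : MvPolynomial (Fin 2) F) := by
      rw [MvPolynomial.smul_eq_C_mul, map_natCast, mul_comm]
    rw [h2, hc]
    refine Submodule.sum_mem _ fun j hj => ?_
    have h3 : ((k.choose j : ℕ) : MvPolynomial (Fin 2) F) * (x ^ j * y ^ (k - j))
          * MvPolynomial.C ((s j).coeff i)
        = (s j).coeff i • (((k.choose j : ℕ) : F) • (x ^ j * y ^ (k - j))) := by
      rw [MvPolynomial.smul_eq_C_mul, MvPolynomial.smul_eq_C_mul, map_natCast, mul_comm]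
    rw [h3]
    exact Submodule.smul_mem _ _
      (choose_smul_mem F k j (Nat.lt_succ_iff.1 (Finset.mem_range.1 hj)))
  change polyRep F g (x ^ i * y ^ (k - i)) ∈ simpleSubmodule F k
  rw [hg]
  exact (Submodule.smul_mem_iff _ hne).1 hmem

/-- The representation `L_k` of `SL₂(F)`, as a subrepresentation of `F[X, Y]`. -/
def simpleSubrep (F : Type*) [Field F] (k : ℕ) : Subrepresentation (polyRep F) where
  toSubmodule := simpleSubmodule F k
  apply_mem_toSubmodule g _ hf := polyRep_mem_simpleSubmodule k g hf

/-- The Steinberg module of `SL₂(𝔽_q)`: the representation `L_{q - 1}`. -/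
def steinberg (F : Type*) [Field F] [Fintype F] :
    Representation F (SpecialLinearGroup (Fin 2) F) (simpleSubmodule F (Fintype.card F - 1)) :=
  (simpleSubrep F (Fintype.card F - 1)).toRepresentation

open scoped Classical in
/-- For a generator `α` of `κˣ` and a root of unity `ξ ∈ ℂ` of exact order `#κˣ`: the homomorphism
of multiplicative monoids `κ → ℂ` that maps `α` to `ξ` and `0` to `0`. -/
def rootLift {κ : Type*} [Field κ] [Fintype κ] (α : κˣ) (hα : ∀ x : κˣ, x ∈ Subgroup.zpowers α)
    (ξ : ℂˣ) (hξ : IsPrimitiveRoot ξ (Nat.card κˣ)) : MulChar κ ℂ :=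
  MulChar.ofRootOfUnity (ζ := ξ)
    ((mem_rootsOfUnity _ ξ).2 (by rw [← Nat.card_eq_fintype_card, hξ.pow_eq_one])) hα

/-- The value at `g` of the Brauer character of a finite-dimensional representation `ρ` over `F`,
for a multiplicative lift `χ` of `κ ⊇ F` to `ℂ`: the sum of the lifts of the eigenvalues of `ρ g`
in `κ`, with multiplicity. It is meaningful at the elements `g` of order prime to the
characteristic all of whose eigenvalues on the representation lie in `κ`. -/
def brauerCharacter {F κ G V : Type*} [Field F] [Field κ] [Algebra F κ] [Group G]
    [AddCommGroup V] [Module F V] [Module.Finite F V] (χ : MulChar κ ℂ)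
    (ρ : Representation F G V) (g : G) : ℂ :=
  (((ρ g).charpoly.map (algebraMap F κ)).roots.map χ).sum

/-- The element of `F` whose image in `κ` is `ζ + ζ⁻¹`, if there is one (and `0` otherwise). -/
def torusTrace (F : Type*) {κ : Type*} [Field F] [Field κ] [Algebra F κ] (ζ : κ) : F :=
  open scoped Classical in
  if h : ∃ b : F, algebraMap F κ b = ζ + ζ⁻¹ then h.choose else 0

/-- `ζ + ζ⁻¹` does lie in `F = 𝔽_q` if `ζ` is a `(q - 1)`-th or a `(q + 1)`-th root of unity. -/
theorem algebraMap_torusTrace {F κ : Type*} [Field F] [Fintype F] [Field κ] [Fintype κ]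
    [Algebra F κ] (ζ : κ)
    (hζ : ζ ^ (Fintype.card F - 1) = 1 ∨ ζ ^ (Fintype.card F + 1) = 1) :
    algebraMap F κ (torusTrace F ζ) = ζ + ζ⁻¹ := by
  have hq : 1 < Fintype.card F := Fintype.one_lt_card
  have h0 : ζ ≠ 0 := by
    rintro rfl
    rcases hζ with h | h
    · rw [zero_pow (by omega)] at h
      exact zero_ne_one h
    · rw [zero_pow (by omega)] at h
      exact zero_ne_one h
  have hfix : (ζ + ζ⁻¹) ^ Fintype.card F = ζ + ζ⁻¹ := by
    have hadd : (ζ + ζ⁻¹) ^ Fintype.card F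
        = ζ ^ Fintype.card F + (ζ⁻¹) ^ Fintype.card F :=
      map_add (FiniteField.frobeniusAlgHom F κ) ζ ζ⁻¹
    rw [hadd, inv_pow]
    rcases hζ with h | h
    · have h1 : ζ ^ Fintype.card F = ζ := by
        rw [show Fintype.card F = Fintype.card F - 1 + 1 by omega, pow_succ, h, one_mul]
      rw [h1]
    · have h1 : ζ ^ Fintype.card F = ζ⁻¹ := by
        rw [pow_succ] at h
        exact eq_inv_of_mul_eq_one_left h
      rw [h1, inv_inv, add_comm]
  have hex : ∃ b : F, algebraMap F κ b = ζ + ζ⁻¹ := by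
    have hroot : ζ + ζ⁻¹ ∈ ((Polynomial.X ^ Fintype.card F - Polynomial.X :
        Polynomial F).map (algebraMap F κ)).roots := by
      rw [Polynomial.mem_roots (Polynomial.map_ne_zero
        (FiniteField.X_pow_card_sub_X_ne_zero F hq))]
      simp [Polynomial.IsRoot, hfix]
    have hsplit : (Polynomial.X ^ Fintype.card F - Polynomial.X : Polynomial F).roots.map
        (algebraMap F κ) = ((Polynomial.X ^ Fintype.card F - Polynomial.X :
        Polynomial F).map (algebraMap F κ)).roots := by
      apply Polynomial.roots_map_of_injective_of_card_eq_natDegree (algebraMap F κ).injective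
      rw [FiniteField.roots_X_pow_card_sub_X, FiniteField.X_pow_card_sub_X_natDegree_eq F hq]
      rfl
    rw [← hsplit] at hroot
    obtain ⟨b, _, hb⟩ := Multiset.mem_map.1 hroot
    exact ⟨b, hb⟩
  rw [torusTrace, dif_pos hex]
  exact hex.choose_spec

/-- The matrix `A_ζ ∈ SL₂(F)`: it is `± 1` if `ζ = ± 1`, and `(0, -1; 1, ζ + ζ⁻¹)` otherwise. -/
def torusMatrix (F : Type*) {κ : Type*} [Field F] [Field κ] [Algebra F κ] (ζ : κ) :
    SpecialLinearGroup (Fin 2) F :=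
  open scoped Classical in
  if ζ = 1 then 1
  else if ζ = -1 then -1
  else ⟨!![0, -1; 1, torusTrace F ζ], by simp [Matrix.det_fin_two]⟩

end SLTwo

end

/-!
The Steinberg module of `SL₂(F)`, `#F = q`, is spanned by the powers `(a X + b Y) ^ (q - 1)`, one
for each point `(a : b)` of the projective line `P` over `F`, and the only relation among them is
that their sum vanishes. Intertwining maps from it into a representation `W` are therefore
equivariant maps `P → W` with sum zero; let `s` be the dimension of their space.

Off the diagonal, `P × P` is one orbit, with the split torus `T` as a stabilizer. In the projective
line `Q` over the quadratic extension `K` of `F`, the complement of `P` is one orbit, with the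
nonsplit torus `T'` as a stabilizer. Since `#P` and `#Q` are `1` in `F`, comparing dimensions of
spaces of equivariant maps on `P × P` and on `Q` gives `dim W^T = s + d` and `s' = s + dim W^T'`,
where `s'` is the analogue of `s` for `Q`, and `d` is the dimension of the space of equivariant maps
`P × P → W` whose sum over either variable is zero. The kernel
`cross w x ^ (q - 1) * cross w y ^ (q * (q - 1))`, for `w ∈ Q` and `x, y ∈ P`, is invariant and
induces an isomorphism between the spaces of dimensions `s'` and `d`: this is the decomposition of
the Steinberg module of `SL₂(K)` as the tensor product of the module of binary forms of degree
`q - 1` and its Frobenius twist. Hence `d = s'`, and `2 s = dim W^T - dim W^T'`.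

As the orders of `T` and `T'` are prime to the characteristic, the average of the Brauer character
over either torus is the dimension of the space of vectors fixed by it.
-/

noncomputable section

namespace SLTwo

open Matrix Module
open scoped LinearAlgebra.Projectivization

section EquivariantMaps

variable {k G W X Y : Type*} [Field k] [Group G] [AddCommGroup W] [Module k W]
  [MulAction G X] [MulAction G Y]

/-- The space of maps from a `G`-set `X` to a representation of `G` that commute with `G`. -/
def equivariantMaps (ρ : Representation k G W) (X : Type*) [MulAction G X] :
    Submodule k (X → W) where
  carrier := {f | ∀ (g : G) (x : X), f (g • x) = ρ g (f x)}
  add_mem' hf hf' g x := by simp only [Pi.add_apply, hf g x, hf' g x, map_add]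
  zero_mem' g x := by simp only [Pi.zero_apply, map_zero]
  smul_mem' c f hf g x := by simp only [Pi.smul_apply, hf g x, map_smul]

/-- The space of vectors of a representation that are fixed by a subgroup. -/
def fixedVectors (ρ : Representation k G W) (H : Subgroup G) : Submodule k W :=
  Representation.invariants (ρ.comp H.subtype)

theorem mem_fixedVectors {ρ : Representation k G W} {H : Subgroup G} {w : W} :
    w ∈ fixedVectors ρ H ↔ ∀ h ∈ H, ρ h w = w := by
  simp [fixedVectors]

theorem apply_mem_fixedVectors_stabilizer {ρ : Representation k G W} {f : X → W}
    (hf : f ∈ equivariantMaps ρ X) (x : X) :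
    f x ∈ fixedVectors ρ (MulAction.stabilizer G x) :=
  mem_fixedVectors.2 fun h hh => by rw [← hf h x, MulAction.mem_stabilizer_iff.1 hh]

theorem apply_eq_of_smul_eq {ρ : Representation k G W} {x : X} {w : W}
    (hw : w ∈ fixedVectors ρ (MulAction.stabilizer G x)) {g g' : G} (h : g • x = g' • x) :
    ρ g w = ρ g' w := by
  have hfix : ρ (g'⁻¹ * g) w = w := mem_fixedVectors.1 hw _ <| by
    rw [MulAction.mem_stabilizer_iff, mul_smul, h, inv_smul_smul]
  rw [← mul_inv_cancel_left g' g, map_mul, Module.End.mul_apply, hfix]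

theorem smul_mem_range_iff (i : Y →[G] X) (g : G) (x : X) :
    g • x ∈ Set.range i ↔ x ∈ Set.range i := by
  refine ⟨fun ⟨y, hy⟩ => ⟨g⁻¹ • y, ?_⟩, fun ⟨y, hy⟩ => ⟨g • y, ?_⟩⟩
  · rw [map_smul, hy, inv_smul_smul]
  · rw [map_smul, hy]

open scoped Classical in
/-- A map on `X` glued from a map on a copy of `Y` in `X` and a value at a point outside of it,
spread along the orbit of that point; it is `0` elsewhere. -/
def glue (ρ : Representation k G W) (i : Y → X) (z : X) (f : Y → W) (w : W) (x : X) : W :=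
  if h : ∃ y, i y = x then f h.choose else if h : ∃ g : G, g • z = x then ρ h.choose w else 0

theorem glue_apply_left {Y : Type*} {ρ : Representation k G W} {i : Y → X}
    (hi : Function.Injective i) (z : X) (f : Y → W) (w : W) (y : Y) :
    glue ρ i z f w (i y) = f y := by
  have h : ∃ y', i y' = i y := ⟨y, rfl⟩
  rw [glue, dif_pos h, hi h.choose_spec]

theorem glue_apply_smul {ρ : Representation k G W} {i : Y →[G] X} {z : X}
    (hz : z ∉ Set.range i) (f : Y → W) {w : W}
    (hw : w ∈ fixedVectors ρ (MulAction.stabilizer G z)) (g : G) :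
    glue ρ i z f w (g • z) = ρ g w := by
  have hg : ∃ g' : G, g' • z = g • z := ⟨g, rfl⟩
  rw [glue, dif_neg (show ¬∃ y, i y = g • z from mt (smul_mem_range_iff i g z).1 hz), dif_pos hg]
  exact apply_eq_of_smul_eq hw hg.choose_spec

theorem glue_mem_equivariantMaps {ρ : Representation k G W} {i : Y →[G] X}
    (hi : Function.Injective i) {z : X} (hz : z ∉ Set.range i)
    (hX : ∀ x ∉ Set.range i, x ∈ MulAction.orbit G z) {f : Y → W}
    (hf : f ∈ equivariantMaps ρ Y) {w : W}
    (hw : w ∈ fixedVectors ρ (MulAction.stabilizer G z)) :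
    glue ρ i z f w ∈ equivariantMaps ρ X := by
  intro g x
  by_cases hx : x ∈ Set.range i
  · obtain ⟨y, rfl⟩ := hx
    rw [← map_smul, glue_apply_left hi, glue_apply_left hi, hf]
  · obtain ⟨g', rfl⟩ := hX x hx
    simp only [← mul_smul, glue_apply_smul hz f hw, map_mul, Module.End.mul_apply]

theorem finrank_equivariantMaps_of_range_union_orbit [Finite Y] [Module.Finite k W]
    (ρ : Representation k G W) {i : Y →[G] X} (hi : Function.Injective i) {z : X}
    (hz : z ∉ Set.range i) (hX : ∀ x ∉ Set.range i, x ∈ MulAction.orbit G z) :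
    finrank k (equivariantMaps ρ X)
      = finrank k (equivariantMaps ρ Y)
        + finrank k (fixedVectors ρ (MulAction.stabilizer G z)) := by
  let restrict : equivariantMaps ρ X →ₗ[k]
      equivariantMaps ρ Y × fixedVectors ρ (MulAction.stabilizer G z) :=
    LinearMap.prod
      ((LinearMap.funLeft k W i).restrict fun f hf g y => by
        simp only [LinearMap.funLeft_apply, map_smul, hf g])
      ((LinearMap.proj z).restrict fun f hf => apply_mem_fixedVectors_stabilizer hf z)
  rw [← finrank_prod]
  refine (LinearEquiv.ofBijective restrict ⟨fun f f' hff' => ?_, fun ⟨f, w⟩ => ?_⟩).finrank_eq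
  · obtain ⟨hY, hz'⟩ := Prod.ext_iff.1 hff'
    refine Subtype.ext (funext fun x => ?_)
    by_cases hx : x ∈ Set.range i
    · obtain ⟨y, rfl⟩ := hx
      exact congrFun (congrArg Subtype.val hY) y
    · obtain ⟨g, rfl⟩ := hX x hx
      have hval : f.1 z = f'.1 z := congrArg Subtype.val hz'
      simp only [f.2 g z, f'.2 g z, hval]
  · refine ⟨⟨_, glue_mem_equivariantMaps hi hz hX f.2 w.2⟩, Prod.ext ?_ ?_⟩ <;> ext1
    · exact funext (glue_apply_left hi z f.1 w.1)
    · have h := glue_apply_smul hz f.1 w.2 1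
      rwa [one_smul, map_one, Module.End.one_apply] at h

end EquivariantMaps

section SumZero

variable {k G W X Y : Type*} [Field k] [Group G] [AddCommGroup W] [Module k W]
  [MulAction G X] [MulAction G Y]

/-- The space of equivariant maps whose values add up to zero. -/
def sumZeroMaps (ρ : Representation k G W) (X : Type*) [MulAction G X] [Fintype X] :
    Submodule k (X → W) :=
  equivariantMaps ρ X ⊓ LinearMap.ker (∑ x, LinearMap.proj x : (X → W) →ₗ[k] W)

theorem mem_sumZeroMaps [Fintype X] {ρ : Representation k G W} {f : X → W} :
    f ∈ sumZeroMaps ρ X ↔ f ∈ equivariantMaps ρ X ∧ ∑ x, f x = 0 := by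
  simp [sumZeroMaps]

/-- The linear map that sums a function of two variables over the first one. -/
def sumFst (k W X Y : Type*) [Field k] [AddCommGroup W] [Module k W] [Fintype X] :
    (X × Y → W) →ₗ[k] (Y → W) := LinearMap.pi fun y => ∑ x, LinearMap.proj (x, y)

@[simp]
theorem sumFst_apply [Fintype X] (f : X × Y → W) (y : Y) : sumFst k W X Y f y = ∑ x, f (x, y) := by
  simp [sumFst]

/-- The linear map that sums a function of two variables over the second one. -/
def sumSnd (k W X Y : Type*) [Field k] [AddCommGroup W] [Module k W] [Fintype Y] :
    (X × Y → W) →ₗ[k] (X → W) := LinearMap.pi fun x => ∑ y, LinearMap.proj (x, y)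

@[simp]
theorem sumSnd_apply [Fintype Y] (f : X × Y → W) (x : X) : sumSnd k W X Y f x = ∑ y, f (x, y) := by
  simp [sumSnd]

/-- The space of equivariant maps of two variables whose sum over either variable vanishes. -/
def doublySumZeroMaps (ρ : Representation k G W) (X Y : Type*) [MulAction G X] [MulAction G Y]
    [Fintype X] [Fintype Y] : Submodule k (X × Y → W) :=
  equivariantMaps ρ (X × Y) ⊓ LinearMap.ker (sumFst k W X Y) ⊓ LinearMap.ker (sumSnd k W X Y)

theorem mem_doublySumZeroMaps [Fintype X] [Fintype Y] {ρ : Representation k G W} {f : X × Y → W} :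
    f ∈ doublySumZeroMaps ρ X Y ↔ f ∈ equivariantMaps ρ (X × Y)
      ∧ (∀ y, ∑ x, f (x, y) = 0) ∧ ∀ x, ∑ y, f (x, y) = 0 := by
  simp [doublySumZeroMaps, funext_iff, and_assoc]

theorem sum_mem_invariants [Fintype X] {ρ : Representation k G W} {f : X → W}
    (hf : f ∈ equivariantMaps ρ X) : ∑ x, f x ∈ ρ.invariants := fun g => by
  rw [map_sum, ← Equiv.sum_comp (MulAction.toPerm g) f]
  exact Finset.sum_congr rfl fun x _ => (hf g x).symm

theorem sumFst_mem_equivariantMaps [Fintype X] {ρ : Representation k G W} {f : X × Y → W}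
    (hf : f ∈ equivariantMaps ρ (X × Y)) : sumFst k W X Y f ∈ equivariantMaps ρ Y := by
  intro g y
  rw [sumFst_apply, sumFst_apply, map_sum, ← Equiv.sum_comp (MulAction.toPerm g)]
  exact Finset.sum_congr rfl fun x _ => hf g (x, y)

theorem sumSnd_mem_equivariantMaps [Fintype Y] {ρ : Representation k G W} {f : X × Y → W}
    (hf : f ∈ equivariantMaps ρ (X × Y)) : sumSnd k W X Y f ∈ equivariantMaps ρ X := by
  intro g x
  rw [sumSnd_apply, sumSnd_apply, map_sum, ← Equiv.sum_comp (MulAction.toPerm g)]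
  exact Finset.sum_congr rfl fun y _ => hf g (x, y)

theorem sum_inv_card_smul [Fintype X] (hX : (Fintype.card X : k) ≠ 0) (w : W) :
    ∑ _x : X, (Fintype.card X : k)⁻¹ • w = w := by
  rw [Finset.sum_const, Finset.card_univ, ← Nat.cast_smul_eq_nsmul k, smul_inv_smul₀ hX]

theorem finrank_eq_finrank_add_finrank_inf_ker {M N : Type*} [AddCommGroup M] [Module k M]
    [AddCommGroup N] [Module k N] {S : Submodule k M} [Module.Finite k S] {T : Submodule k N}
    {e : M →ₗ[k] N} (hST : ∀ x ∈ S, e x ∈ T) (hTS : ∀ y ∈ T, ∃ x ∈ S, e x = y) :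
    finrank k S = finrank k T + finrank k (S ⊓ LinearMap.ker e : Submodule k M) := by
  obtain rfl : S.map e = T := le_antisymm (Submodule.map_le_iff_le_comap.2 hST) hTS
  rw [← LinearMap.finrank_range_add_finrank_ker (e.domRestrict S), LinearMap.range_domRestrict,
    LinearMap.ker_domRestrict, ← Submodule.map_comap_subtype]
  congr 1
  exact (Submodule.finrank_map_subtype_eq _ _).symm

variable [Module.Finite k W] [Fintype X] [Fintype Y]

theorem finrank_equivariantMaps_eq_invariants_add (ρ : Representation k G W)
    (hX : (Fintype.card X : k) ≠ 0) :
    finrank k (equivariantMaps ρ X)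
      = finrank k ρ.invariants + finrank k (sumZeroMaps ρ X) := by
  refine finrank_eq_finrank_add_finrank_inf_ker (fun f hf => ?_) fun w hw =>
    ⟨fun _ => (Fintype.card X : k)⁻¹ • w, fun g _ => ?_, ?_⟩
  · simpa using sum_mem_invariants hf
  · rw [map_smul, hw g]
  · simpa using sum_inv_card_smul hX w

theorem finrank_equivariantMaps_prod (ρ : Representation k G W)
    (hX : (Fintype.card X : k) ≠ 0) (hY : (Fintype.card Y : k) ≠ 0) :
    finrank k (equivariantMaps ρ (X × Y)) = finrank k (equivariantMaps ρ Y)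
      + (finrank k (sumZeroMaps ρ X) + finrank k (doublySumZeroMaps ρ X Y)) := by
  rw [finrank_eq_finrank_add_finrank_inf_ker fun f => sumFst_mem_equivariantMaps (X := X),
    finrank_eq_finrank_add_finrank_inf_ker (T := sumZeroMaps ρ X) (e := sumSnd k W X Y)]
  · rfl
  · rintro f ⟨hf, hf0⟩
    refine mem_sumZeroMaps.2 ⟨sumSnd_mem_equivariantMaps hf, ?_⟩
    simp only [sumSnd_apply]
    rw [Finset.sum_comm]
    exact Finset.sum_eq_zero fun y _ => by simpa using congrFun (LinearMap.mem_ker.1 hf0) y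
  · intro f hf
    obtain ⟨hf, hf0⟩ := mem_sumZeroMaps.1 hf
    refine ⟨fun p => (Fintype.card Y : k)⁻¹ • f p.1, ⟨fun g p => ?_, ?_⟩, ?_⟩
    · simp only [Prod.smul_fst, hf g, map_smul]
    · ext y
      simp [← Finset.smul_sum, hf0]
    · ext x
      simpa using sum_inv_card_smul hY (f x)
  · refine fun f hf => ⟨fun p => (Fintype.card X : k)⁻¹ • f p.2, fun g p => ?_, ?_⟩
    · simp only [Prod.smul_snd, hf g, map_smul]
    · ext y
      simpa using sum_inv_card_smul hX (f y)

theorem finrank_equivariantMaps_of_subsingleton [Subsingleton G] (ρ : Representation k G W) :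
    finrank k (equivariantMaps ρ X) = Fintype.card X * finrank k W := by
  have htop : equivariantMaps ρ X = ⊤ := eq_top_iff.2 fun f _ g x => by
    rw [Subsingleton.elim g 1, one_smul, map_one, Module.End.one_apply]
  rw [htop, finrank_top, finrank_pi_fintype, Finset.sum_const, Finset.card_univ, smul_eq_mul]

theorem finrank_sumZeroMaps_of_subsingleton [Subsingleton G] (ρ : Representation k G W)
    (hX : (Fintype.card X : k) ≠ 0) :
    finrank k (sumZeroMaps ρ X) = (Fintype.card X - 1) * finrank k W := by
  have hinv : ρ.invariants = ⊤ := eq_top_iff.2 fun w _ g => by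
    rw [Subsingleton.elim g 1, map_one, Module.End.one_apply]
  have h := finrank_equivariantMaps_eq_invariants_add ρ hX
  rw [finrank_equivariantMaps_of_subsingleton, hinv, finrank_top] at h
  rw [Nat.sub_one_mul, h, Nat.add_sub_cancel_left]

theorem finrank_doublySumZeroMaps_of_subsingleton [Subsingleton G] (ρ : Representation k G W)
    (hX : (Fintype.card X : k) ≠ 0) (hY : (Fintype.card Y : k) ≠ 0) :
    finrank k (doublySumZeroMaps ρ X Y)
      = (Fintype.card X - 1) * ((Fintype.card Y - 1) * finrank k W) := by
  have h := finrank_equivariantMaps_prod ρ hX hY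
  rw [finrank_equivariantMaps_of_subsingleton, finrank_equivariantMaps_of_subsingleton,
    finrank_sumZeroMaps_of_subsingleton ρ hX, Fintype.card_prod] at h
  obtain ⟨m, hm⟩ := Nat.exists_eq_succ_of_ne_zero fun h0 : Fintype.card X = 0 => hX (by simp [h0])
  obtain ⟨n, hn⟩ := Nat.exists_eq_succ_of_ne_zero fun h0 : Fintype.card Y = 0 => hY (by simp [h0])
  simp only [hm, hn, Nat.succ_eq_add_one, Nat.add_sub_cancel] at h ⊢
  linear_combination -h

end SumZero

section Cross

variable {R L : Type*} [CommRing R] [Field L]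

/-- The determinant of a pair of vectors in the plane. -/
def cross (v w : Fin 2 → R) : R := v 0 * w 1 - v 1 * w 0

theorem cross_smul_left (a : R) (v w : Fin 2 → R) : cross (a • v) w = a * cross v w := by
  simp only [cross, Pi.smul_apply, smul_eq_mul]
  ring

theorem cross_smul_right (a : R) (v w : Fin 2 → R) : cross v (a • w) = a * cross v w := by
  simp only [cross, Pi.smul_apply, smul_eq_mul]
  ring

theorem smul_apply_fin_two (g : SpecialLinearGroup (Fin 2) R) (v : Fin 2 → R) (i : Fin 2) :
    (g • v) i = g.1 i 0 * v 0 + g.1 i 1 * v 1 :=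
  Fin.sum_univ_two fun j => g.1 i j * v j

theorem cross_mulVec (M : Matrix (Fin 2) (Fin 2) R) (v w : Fin 2 → R) :
    cross (M *ᵥ v) (M *ᵥ w) = M.det * cross v w := by
  simp only [cross, mulVec, dotProduct, Fin.sum_univ_two, det_fin_two]
  ring

theorem cross_smul_smul (g : SpecialLinearGroup (Fin 2) R) (v w : Fin 2 → R) :
    cross (g • v) (g • w) = cross v w :=
  (cross_mulVec g.1 v w).trans (by rw [g.det_coe, one_mul])

theorem cross_eq_zero_iff {v w : Fin 2 → L} (hw : w ≠ 0) :
    cross v w = 0 ↔ ∃ a : L, a • w = v := by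
  refine ⟨fun h => ?_, ?_⟩
  · obtain ⟨i, hi⟩ := Function.ne_iff.1 hw
    have hi : w i ≠ 0 := hi
    refine ⟨v i / w i, funext fun j => ?_⟩
    have hij : v i * w j = v j * w i := by
      rw [cross, sub_eq_zero] at h
      fin_cases i <;> fin_cases j <;> simp [h]
    rw [Pi.smul_apply, smul_eq_mul, div_mul_eq_mul_div, hij, mul_div_cancel_right₀ _ hi]
  · rintro ⟨a, rfl⟩
    rw [cross_smul_left, cross]
    ring

theorem mk_eq_mk_iff_cross {v w : Fin 2 → L} {hv : v ≠ 0} {hw : w ≠ 0} :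
    Projectivization.mk L v hv = .mk L w hw ↔ cross v w = 0 := by
  rw [Projectivization.mk_eq_mk_iff', cross_eq_zero_iff hw]

theorem eq_iff_cross_rep {p p' : ℙ L (Fin 2 → L)} : p = p' ↔ cross p.rep p'.rep = 0 := by
  rw [← mk_eq_mk_iff_cross (hv := p.rep_nonzero) (hw := p'.rep_nonzero), p.mk_rep, p'.mk_rep]

end Cross

section PowerSums

variable {F : Type*} [Field F] [Fintype F]

theorem sum_eq_card_sub_one_nsmul_sum_rep {E M : Type*} [AddCommGroup E] [Module F E] [Fintype E]
    [Fintype (ℙ F E)] [AddCommMonoid M] {h : E → M} (h0 : h 0 = 0)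
    (hh : ∀ (c : Fˣ) (v : E), h (c • v) = h v) :
    ∑ v, h v = (Fintype.card F - 1) • ∑ p : ℙ F E, h p.rep := by
  classical
  have hrep (v : {v : E // v ≠ 0}) : h v = h (Projectivization.mk F v.1 v.2).rep := by
    obtain ⟨c, hc⟩ := Projectivization.exists_smul_eq_mk_rep F v.1 v.2
    rw [← hc, hh]
  have hfst (v : {v : E // v ≠ 0}) : Projectivization.mk F v.1 v.2
      = (Projectivization.nonZeroEquivProjectivizationProdUnits F E v).1 := rfl
  rw [Fintype.sum_eq_add_sum_subtype_ne h 0, h0, zero_add]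
  simp only [hrep, hfst]
  rw [(Projectivization.nonZeroEquivProjectivizationProdUnits F E).sum_comp
      fun a => h a.1.rep,
    Fintype.sum_prod_type]
  simp only [Finset.sum_const, Finset.card_univ, Fintype.card_units, Finset.sum_nsmul]

instance : Fintype (ℙ F (Fin 2 → F)) := Fintype.ofFinite _

theorem card_projectiveLine : Fintype.card (ℙ F (Fin 2 → F)) = Fintype.card F + 1 := by
  rw [← Nat.card_eq_fintype_card, ← Nat.card_eq_fintype_card,
    Projectivization.card_of_finrank_two F (Fin 2 → F) (by simp)]

theorem cast_card_projectiveLine (k : Type*) [CommRing k] [Algebra F k] :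
    (Fintype.card (ℙ F (Fin 2 → F)) : k) = 1 := by
  rw [card_projectiveLine, Nat.cast_add_one, ← map_natCast (algebraMap F k),
    FiniteField.cast_card_eq_zero, map_zero, zero_add]

theorem cast_card_sub_one (R : Type*) [CommRing R] [Algebra F R] :
    ((Fintype.card F - 1 : ℕ) : R) = -1 := by
  rw [Nat.cast_sub Fintype.card_pos, ← map_natCast (algebraMap F R),
    FiniteField.cast_card_eq_zero, map_zero, Nat.cast_one, zero_sub]

theorem sum_pow_card_sub_one : ∑ x : F, x ^ (Fintype.card F - 1) = -1 := by
  classical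
  have hone (x : {x : F // x ≠ 0}) : x.1 ^ (Fintype.card F - 1) = 1 :=
    FiniteField.pow_card_sub_one_eq_one x.1 x.2
  rw [Fintype.sum_eq_add_sum_subtype_ne _ 0,
    zero_pow (Nat.sub_ne_zero_of_lt Fintype.one_lt_card), zero_add]
  simp only [hone, Finset.sum_const, nsmul_one, Finset.card_univ,
    Fintype.card_subtype_compl, Fintype.card_subtype_eq, cast_card_sub_one F]

theorem sum_rep_pow_mul_rep_pow {a b : ℕ} (hab : a + b = 2 * (Fintype.card F - 1)) :
    ∑ p : ℙ F (Fin 2 → F), p.rep 0 ^ a * p.rep 1 ^ b =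
      if a = Fintype.card F - 1 then -1 else 0 := by
  have hF : 1 < Fintype.card F := Fintype.one_lt_card
  have hplane := sum_eq_card_sub_one_nsmul_sum_rep (F := F)
    (h := fun v : Fin 2 → F => v 0 ^ a * v 1 ^ b)
    (by rcases Nat.eq_zero_or_pos a with ha | ha
        · simp [show b ≠ 0 by omega]
        · simp [ha.ne'])
    (fun c v => by
      have hc : (c : F) ^ a * (c : F) ^ b = 1 := by
        rw [← pow_add, hab, mul_comm, pow_mul,
          FiniteField.pow_card_sub_one_eq_one _ c.ne_zero, one_pow]
      simp only [Pi.smul_apply, Units.smul_def, smul_eq_mul, mul_pow]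
      linear_combination (v 0 ^ a * v 1 ^ b) * hc)
  rw [nsmul_eq_mul, cast_card_sub_one F, neg_one_mul, ← (finTwoArrowEquiv F).symm.sum_comp,
    Fintype.sum_prod_type] at hplane
  simp only [finTwoArrowEquiv_symm_apply, cons_val_zero, cons_val_one, ← Finset.sum_mul_sum]
    at hplane
  rw [← neg_eq_iff_eq_neg.2 hplane]
  rcases lt_trichotomy a (Fintype.card F - 1) with ha | ha | ha
  · rw [FiniteField.sum_pow_lt_card_sub_one F a ha, if_neg ha.ne, zero_mul, neg_zero]
  · rw [if_pos ha, ha, show b = Fintype.card F - 1 by omega, sum_pow_card_sub_one]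
    norm_num
  · rw [FiniteField.sum_pow_lt_card_sub_one F b (by omega), if_neg ha.ne', mul_zero, neg_zero]

theorem sub_pow_card (F : Type*) {R : Type*} [Field F] [Fintype F] [CommRing R] [Algebra F R]
    (a b : R) : (a - b) ^ Fintype.card F = a ^ Fintype.card F - b ^ Fintype.card F :=
  map_sub (FiniteField.frobeniusAlgHom F R) a b

theorem neg_pow_card (F : Type*) {R : Type*} [Field F] [Fintype F] [CommRing R] [Algebra F R]
    (a : R) : (-a) ^ Fintype.card F = -a ^ Fintype.card F :=
  map_neg (FiniteField.frobeniusAlgHom F R) a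

theorem sum_pow_card (F : Type*) {R ι : Type*} [Field F] [Fintype F] [CommRing R] [Algebra F R]
    (s : Finset ι) (f : ι → R) :
    ∑ i ∈ s, f i ^ Fintype.card F = (∑ i ∈ s, f i) ^ Fintype.card F :=
  (map_sum (FiniteField.frobeniusAlgHom F R) f s).symm

theorem sub_pow_card_sub_one (F : Type*) {R : Type*} [Field F] [Fintype F] [CommRing R]
    [IsDomain R] [Algebra F R] (a b : R) :
    (a - b) ^ (Fintype.card F - 1)
      = ∑ i ∈ Finset.range (Fintype.card F), a ^ i * b ^ (Fintype.card F - 1 - i) := by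
  rcases eq_or_ne a b with rfl | hab
  · have hterm : ∀ i ∈ Finset.range (Fintype.card F),
        a ^ i * a ^ (Fintype.card F - 1 - i) = a ^ (Fintype.card F - 1) := fun i hi => by
      rw [← pow_add, Nat.add_sub_cancel' (Nat.le_sub_one_of_lt (Finset.mem_range.1 hi))]
    rw [sub_self, zero_pow (Nat.sub_ne_zero_of_lt Fintype.one_lt_card), Finset.sum_congr rfl hterm,
      Finset.sum_const, Finset.card_range, nsmul_eq_mul, ← map_natCast (algebraMap F R),
      FiniteField.cast_card_eq_zero, map_zero, zero_mul]
  · refine mul_right_cancel₀ (sub_ne_zero.2 hab) ?_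
    rw [← pow_succ, Nat.sub_add_cancel Fintype.card_pos, sub_pow_card, geom_sum₂_mul]

/-- Homogeneous coordinates in an `F`-algebra of a point of the projective line over `F`. -/
def coords (R : Type*) [CommRing R] [Algebra F R] (x : ℙ F (Fin 2 → F)) : Fin 2 → R :=
  fun i => algebraMap F R (x.rep i)

/-- Up to sign, `(w, x) ↦ cross w x ^ (q - 1)` is a reproducing kernel for the binary forms of
degree `q - 1` on the projective line. -/
theorem sum_coords_pow_mul_cross_pow {R : Type*} [CommRing R] [IsDomain R] [Algebra F R]
    (w : Fin 2 → R) {a b : ℕ} (hab : a + b = Fintype.card F - 1) :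
    ∑ x : ℙ F (Fin 2 → F), coords R x 0 ^ a * coords R x 1 ^ b
        * cross w (coords R x) ^ (Fintype.card F - 1) = -(w 0 ^ a * w 1 ^ b) := by
  have hF : 1 < Fintype.card F := Fintype.one_lt_card
  have hexpand (x : ℙ F (Fin 2 → F)) : coords R x 0 ^ a * coords R x 1 ^ b
        * cross w (coords R x) ^ (Fintype.card F - 1)
      = ∑ i ∈ Finset.range (Fintype.card F), w 0 ^ i * w 1 ^ (Fintype.card F - 1 - i)
          * algebraMap F R (x.rep 0 ^ (a + (Fintype.card F - 1 - i)) * x.rep 1 ^ (b + i)) := by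
    rw [cross, sub_pow_card_sub_one F, Finset.mul_sum]
    refine Finset.sum_congr rfl fun i _ => ?_
    simp only [coords, map_mul, map_pow]
    ring
  have hmoment (i : ℕ) (hi : i ∈ Finset.range (Fintype.card F)) :
      ∑ x : ℙ F (Fin 2 → F), w 0 ^ i * w 1 ^ (Fintype.card F - 1 - i)
          * algebraMap F R (x.rep 0 ^ (a + (Fintype.card F - 1 - i)) * x.rep 1 ^ (b + i))
        = if i = a then -(w 0 ^ a * w 1 ^ b) else 0 := by
    have hi : i < Fintype.card F := Finset.mem_range.1 hi
    rw [← Finset.mul_sum, ← map_sum, sum_rep_pow_mul_rep_pow (by omega)]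
    rcases eq_or_ne i a with rfl | hia
    · rw [if_pos (by omega), if_pos rfl, map_neg, map_one, mul_neg_one,
        show Fintype.card F - 1 - i = b by omega]
    · rw [if_neg (by omega), if_neg hia, map_zero, mul_zero]
  rw [Finset.sum_congr rfl fun x _ => hexpand x, Finset.sum_comm, Finset.sum_congr rfl hmoment,
    Finset.sum_ite_eq', if_pos (Finset.mem_range.2 (by omega))]

end PowerSums

section CrossSums

variable {F K R : Type*} [Field F] [Fintype F] [Field K] [CommRing R]

theorem cross_coords [Algebra K R] (x y : ℙ K (Fin 2 → K)) :
    cross (coords R x) (coords R y) = algebraMap K R (cross x.rep y.rep) := by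
  simp only [cross, coords, map_sub, map_mul]

variable [Algebra F R]

open scoped Classical in
theorem cross_coords_pow (x y : ℙ F (Fin 2 → F)) :
    cross (coords R x) (coords R y) ^ (Fintype.card F - 1) = if x = y then 0 else 1 := by
  rw [cross_coords, ← map_pow]
  split_ifs with h
  · rw [eq_iff_cross_rep.1 h, zero_pow (Nat.sub_ne_zero_of_lt Fintype.one_lt_card), map_zero]
  · rw [FiniteField.pow_card_sub_one_eq_one _ (mt eq_iff_cross_rep.2 h), map_one]

variable [IsDomain R]

theorem sum_cross_pow_mul_cross_pow (v w : Fin 2 → R) :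
    ∑ x : ℙ F (Fin 2 → F), cross v (coords R x) ^ (Fintype.card F - 1)
        * cross w (coords R x) ^ (Fintype.card F - 1) = -cross v w ^ (Fintype.card F - 1) := by
  have hexpand (x : ℙ F (Fin 2 → F)) : cross v (coords R x) ^ (Fintype.card F - 1)
        * cross w (coords R x) ^ (Fintype.card F - 1)
      = ∑ i ∈ Finset.range (Fintype.card F), v 0 ^ i * v 1 ^ (Fintype.card F - 1 - i)
          * (coords R x 0 ^ (Fintype.card F - 1 - i) * coords R x 1 ^ i
            * cross w (coords R x) ^ (Fintype.card F - 1)) := by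
    rw [cross, sub_pow_card_sub_one F, Finset.sum_mul]
    refine Finset.sum_congr rfl fun i _ => ?_
    ring
  rw [Finset.sum_congr rfl fun x _ => hexpand x, Finset.sum_comm, cross, sub_pow_card_sub_one F,
    ← Finset.sum_neg_distrib]
  refine Finset.sum_congr rfl fun i hi => ?_
  rw [← Finset.mul_sum, sum_coords_pow_mul_cross_pow w
    (Nat.sub_add_cancel (Nat.le_sub_one_of_lt (Finset.mem_range.1 hi)))]
  ring

theorem sum_cross_pow (v : Fin 2 → R) :
    ∑ x : ℙ F (Fin 2 → F), cross v (coords R x) ^ (Fintype.card F - 1) = 0 := by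
  classical
  have hcount (y : ℙ F (Fin 2 → F)) :
      ∑ x : ℙ F (Fin 2 → F), cross (coords R x) (coords R y) ^ (Fintype.card F - 1) = 0 := by
    simp only [cross_coords_pow]
    rw [Finset.sum_ite, Finset.sum_const_zero, zero_add, Finset.sum_const, nsmul_one,
      ← map_natCast (algebraMap F R), Finset.filter_ne',
      Finset.card_erase_of_mem (Finset.mem_univ y), Finset.card_univ, card_projectiveLine,
      Nat.add_sub_cancel, FiniteField.cast_card_eq_zero, map_zero]
  have hreproduce (x : ℙ F (Fin 2 → F)) : cross v (coords R x) ^ (Fintype.card F - 1)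
      = -∑ y : ℙ F (Fin 2 → F), cross v (coords R y) ^ (Fintype.card F - 1)
          * cross (coords R x) (coords R y) ^ (Fintype.card F - 1) := by
    rw [sum_cross_pow_mul_cross_pow, neg_neg]
  rw [Finset.sum_congr rfl fun x _ => hreproduce x, Finset.sum_neg_distrib, Finset.sum_comm]
  simp only [← Finset.mul_sum, hcount, mul_zero, Finset.sum_const_zero, neg_zero]

end CrossSums

section IntegralTransform

variable {k G W X Y : Type*} [Field k] [Group G] [AddCommGroup W] [Module k W]
  [MulAction G X] [MulAction G Y] [Fintype Y]

/-- The integral transform with a given kernel, from maps on `Y` to maps on `X`. -/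
def integralTransform (W : Type*) [AddCommGroup W] [Module k W] (N : X → Y → k) :
    (Y → W) →ₗ[k] (X → W) :=
  LinearMap.pi fun x => ∑ y, N x y • LinearMap.proj y

theorem integralTransform_apply (N : X → Y → k) (f : Y → W) (x : X) :
    integralTransform W N f x = ∑ y, N x y • f y := by
  simp [integralTransform]

theorem integralTransform_mem_equivariantMaps {ρ : Representation k G W} {N : X → Y → k}
    (hN : ∀ (g : G) x y, N (g • x) (g • y) = N x y) {f : Y → W} (hf : f ∈ equivariantMaps ρ Y) :
    integralTransform W N f ∈ equivariantMaps ρ X := by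
  intro g x
  rw [integralTransform_apply, integralTransform_apply, map_sum,
    ← Equiv.sum_comp (MulAction.toPerm g)]
  refine Finset.sum_congr rfl fun y _ => ?_
  rw [MulAction.toPerm_apply, hN, hf, map_smul]

open scoped Classical in
theorem integralTransform_integralTransform [Fintype X] {N : X → Y → k}
    (hN : ∀ y y', ∑ x, N x y * N x y' = if y = y' then 0 else 1) {f : Y → W} (hf : ∑ y, f y = 0) :
    integralTransform W (fun y x => N x y) (integralTransform W N f) = -f := by
  ext y
  simp only [integralTransform_apply, Finset.smul_sum, smul_smul]
  rw [Finset.sum_comm]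
  have hdelete (y' : Y) : (if y = y' then (0 : k) else 1) • f y'
      = f y' - if y = y' then f y' else 0 := by
    split_ifs <;> simp
  simp only [← Finset.sum_smul, hN, hdelete, Finset.sum_sub_distrib, hf, Finset.sum_ite_eq,
    Finset.mem_univ, if_true, zero_sub, Pi.neg_apply]

end IntegralTransform

section QuadraticPoints

variable {F K k : Type*} [Field F] [Field K]

/-- The action of `SL₂(F)` on the projective line over a quadratic extension `K` of `F`. As it asks
for the degree, it does not compete with the action on the projective line over `F` itself. -/
instance [Algebra F K] [Fact (finrank F K = 2)] :
    MulAction (SpecialLinearGroup (Fin 2) F) (ℙ K (Fin 2 → K)) :=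
  MulAction.compHom _ (SpecialLinearGroup.map (algebraMap F K))

theorem card_quadratic [Algebra F K] [Fact (finrank F K = 2)] [Fintype F] [Fintype K] :
    Fintype.card K = Fintype.card F ^ 2 := by
  rw [Module.card_eq_pow_finrank (K := F) (V := K), Fact.out (p := finrank F K = 2)]

theorem exists_coords_smul {R : Type*} [CommRing R] [Algebra F R]
    (g : SpecialLinearGroup (Fin 2) F) (x : ℙ F (Fin 2 → F)) :
    ∃ c : Fˣ, coords R (g • x)
      = algebraMap F R c • (SpecialLinearGroup.map (algebraMap F R) g • coords R x) := by
  obtain ⟨c, hc⟩ := Projectivization.exists_smul_eq_mk_rep F (g • x.rep)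
    ((smul_ne_zero_iff_ne g).2 x.rep_nonzero)
  rw [← Projectivization.smul_mk g x.rep_nonzero, x.mk_rep] at hc
  refine ⟨c, funext fun i => ?_⟩
  rw [coords, ← hc, Units.smul_def, Pi.smul_apply, smul_apply_fin_two, Pi.smul_apply,
    smul_apply_fin_two]
  simp [coords]

variable [Fintype F] [Field k] [Algebra F k] [Algebra K k]

/-- The kernel `cross w x ^ (q - 1) * cross w y ^ (q * (q - 1))`, which for `#K = q ^ 2` relates
pairs of points over `F` to points over `K`. -/
def pairKernel (k : Type*) [Field k] [Algebra F k] [Algebra K k]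
    (p : ℙ F (Fin 2 → F) × ℙ F (Fin 2 → F)) (w : ℙ K (Fin 2 → K)) : k :=
  cross (coords k w) (coords k p.1) ^ (Fintype.card F - 1)
    * (cross (coords k w) (coords k p.2) ^ (Fintype.card F - 1)) ^ Fintype.card F

theorem sum_pairKernel_left (w : ℙ K (Fin 2 → K)) (y : ℙ F (Fin 2 → F)) :
    ∑ x : ℙ F (Fin 2 → F), pairKernel k (x, y) w = 0 := by
  simp only [pairKernel]
  rw [← Finset.sum_mul, sum_cross_pow, zero_mul]

theorem sum_pairKernel_right (w : ℙ K (Fin 2 → K)) (x : ℙ F (Fin 2 → F)) :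
    ∑ y : ℙ F (Fin 2 → F), pairKernel k (x, y) w = 0 := by
  simp only [pairKernel]
  rw [← Finset.mul_sum, sum_pow_card, sum_cross_pow, zero_pow Fintype.card_ne_zero, mul_zero]

variable {W : Type*} [AddCommGroup W] [Module k W]

theorem sum_integralTransform_pairKernel_left [Fintype K] (f : ℙ K (Fin 2 → K) → W)
    (y : ℙ F (Fin 2 → F)) :
    ∑ x, integralTransform W (pairKernel k) f (x, y) = 0 := by
  simp only [integralTransform_apply]
  rw [Finset.sum_comm]
  simp only [← Finset.sum_smul, sum_pairKernel_left, zero_smul, Finset.sum_const_zero]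

theorem sum_integralTransform_pairKernel_right [Fintype K] (f : ℙ K (Fin 2 → K) → W)
    (x : ℙ F (Fin 2 → F)) :
    ∑ y, integralTransform W (pairKernel k) f (x, y) = 0 := by
  simp only [integralTransform_apply]
  rw [Finset.sum_comm]
  simp only [← Finset.sum_smul, sum_pairKernel_right, zero_smul, Finset.sum_const_zero]

variable [Algebra F K] [Fact (finrank F K = 2)]

open scoped Classical in
theorem sum_pairKernel_mul_pairKernel [Finite K] (w w' : ℙ K (Fin 2 → K)) :
    ∑ p : ℙ F (Fin 2 → F) × ℙ F (Fin 2 → F), pairKernel k p w * pairKernel k p w'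
      = if w = w' then 0 else 1 := by
  have := Fintype.ofFinite K
  have hfactor (x y : ℙ F (Fin 2 → F)) : pairKernel k (x, y) w * pairKernel k (x, y) w'
      = (cross (coords k w) (coords k x) ^ (Fintype.card F - 1)
          * cross (coords k w') (coords k x) ^ (Fintype.card F - 1))
        * (cross (coords k w) (coords k y) ^ (Fintype.card F - 1)
          * cross (coords k w') (coords k y) ^ (Fintype.card F - 1)) ^ Fintype.card F := by
    simp only [pairKernel]
    ring
  have hexp : (Fintype.card F - 1) * (Fintype.card F + 1) = Fintype.card K - 1 := by
    rw [card_quadratic (F := F) (K := K), mul_comm, ← Nat.sq_sub_sq, one_pow]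
  rw [Fintype.sum_prod_type]
  simp only [hfactor]
  rw [← Finset.sum_mul_sum, sum_pow_card, sum_cross_pow_mul_cross_pow, neg_pow_card, neg_mul_neg,
    ← pow_succ', ← pow_mul, hexp, cross_coords_pow]

theorem pairKernel_smul_smul [Finite K] [IsScalarTower F K k]
    (g : SpecialLinearGroup (Fin 2) F)
    (p : ℙ F (Fin 2 → F) × ℙ F (Fin 2 → F)) (w : ℙ K (Fin 2 → K)) :
    pairKernel k (g • p) (g • w) = pairKernel k p w := by
  have := Fintype.ofFinite K
  have hunit (c : Fˣ) : algebraMap F k c ^ (Fintype.card F - 1) = 1 := by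
    rw [← map_pow, FiniteField.pow_card_sub_one_eq_one _ c.ne_zero, map_one]
  obtain ⟨a, ha⟩ := exists_coords_smul (R := k) g p.1
  obtain ⟨b, hb⟩ := exists_coords_smul (R := k) g p.2
  obtain ⟨c, hc⟩ := exists_coords_smul (R := k) (SpecialLinearGroup.map (algebraMap F K) g) w
  have hg : SpecialLinearGroup.map (algebraMap K k) (SpecialLinearGroup.map (algebraMap F K) g)
      = SpecialLinearGroup.map (algebraMap F k) g := by
    ext i j
    exact (IsScalarTower.algebraMap_apply F K k (g.1 i j)).symm
  have hcunit : (algebraMap K k c ^ (Fintype.card F - 1)) ^ (Fintype.card F + 1) = 1 := by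
    rw [← map_pow, ← map_pow, ← pow_mul, mul_comm, ← Nat.sq_sub_sq, ← card_quadratic (K := K),
      one_pow, FiniteField.pow_card_sub_one_eq_one _ c.ne_zero, map_one]
  have hw : coords k (g • w)
      = algebraMap K k c • (SpecialLinearGroup.map (algebraMap F k) g • coords k w) := hg ▸ hc
  simp only [pairKernel, Prod.smul_fst, Prod.smul_snd]
  rw [hw, ha, hb]
  simp only [cross_smul_left, cross_smul_right, cross_smul_smul, mul_pow, hunit, one_mul]
  linear_combination (cross (coords k w) (coords k p.1) ^ (Fintype.card F - 1)
    * (cross (coords k w) (coords k p.2) ^ (Fintype.card F - 1)) ^ Fintype.card F) * hcunit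

variable [Fintype K]

theorem integralTransform_pairKernel_injOn :
    Set.InjOn (integralTransform W (pairKernel (F := F) k))
      {f : ℙ K (Fin 2 → K) → W | ∑ w, f w = 0} := by
  intro f hf f' hf' h
  have horth := sum_pairKernel_mul_pairKernel (F := F) (K := K) (k := k)
  rw [← neg_inj, ← integralTransform_integralTransform horth hf, h,
    integralTransform_integralTransform horth hf']

theorem exists_integralTransform_pairKernel_eq [Module.Finite k W]
    {d : ℙ F (Fin 2 → F) × ℙ F (Fin 2 → F) → W}
    (hleft : ∀ y, ∑ x, d (x, y) = 0) (hright : ∀ x, ∑ y, d (x, y) = 0) :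
    ∃ f : ℙ K (Fin 2 → K) → W, ∑ w, f w = 0 ∧ integralTransform W (pairKernel k) f = d := by
  -- over the trivial group both spaces have dimension `q ^ 2 * finrank k W`
  let G := (⊥ : Subgroup (SpecialLinearGroup (Fin 2) F))
  let ρ : Representation k G W := Representation.trivial k G W
  have hequiv {X : Type _} [MulAction G X] (f : X → W) : f ∈ equivariantMaps ρ X := fun g x => by
    rw [Subsingleton.elim g 1, one_smul, map_one, Module.End.one_apply]
  have hF := cast_card_projectiveLine (F := F) k
  have hK := cast_card_projectiveLine (F := K) k
  let S : sumZeroMaps ρ (ℙ K (Fin 2 → K)) →ₗ[k]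
      doublySumZeroMaps ρ (ℙ F (Fin 2 → F)) (ℙ F (Fin 2 → F)) :=
    (integralTransform W (pairKernel k)).restrict fun f _ => mem_doublySumZeroMaps.2
      ⟨hequiv _, sum_integralTransform_pairKernel_left f, sum_integralTransform_pairKernel_right f⟩
  have hS : Function.Injective S := fun f f' h => Subtype.ext <|
    integralTransform_pairKernel_injOn (F := F) (k := k) (mem_sumZeroMaps.1 f.2).2
      (mem_sumZeroMaps.1 f'.2).2 (congrArg Subtype.val h)
  have hdim : finrank k (sumZeroMaps ρ (ℙ K (Fin 2 → K)))
      = finrank k (doublySumZeroMaps ρ (ℙ F (Fin 2 → F)) (ℙ F (Fin 2 → F))) := by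
    rw [finrank_sumZeroMaps_of_subsingleton ρ (hK ▸ one_ne_zero),
      finrank_doublySumZeroMaps_of_subsingleton ρ (hF ▸ one_ne_zero) (hF ▸ one_ne_zero),
      card_projectiveLine, card_projectiveLine, card_quadratic (F := F) (K := K)]
    simp only [Nat.add_sub_cancel, sq, mul_assoc]
  obtain ⟨f, hf⟩ := (LinearMap.injective_iff_surjective_of_finrank_eq_finrank hdim).1 hS
    ⟨d, mem_doublySumZeroMaps.2 ⟨hequiv d, hleft, hright⟩⟩
  exact ⟨f, (mem_sumZeroMaps.1 f.2).2, congrArg Subtype.val hf⟩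

variable [IsScalarTower F K k]

theorem integralTransform_pairKernel_mem_doublySumZeroMaps
    {ρ : Representation k (SpecialLinearGroup (Fin 2) F) W} {f : ℙ K (Fin 2 → K) → W}
    (hf : f ∈ equivariantMaps ρ (ℙ K (Fin 2 → K))) :
    integralTransform W (pairKernel k) f
      ∈ doublySumZeroMaps ρ (ℙ F (Fin 2 → F)) (ℙ F (Fin 2 → F)) :=
  mem_doublySumZeroMaps.2 ⟨integralTransform_mem_equivariantMaps pairKernel_smul_smul hf,
    sum_integralTransform_pairKernel_left f, sum_integralTransform_pairKernel_right f⟩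

theorem finrank_doublySumZeroMaps_eq_finrank_sumZeroMaps [Module.Finite k W]
    (ρ : Representation k (SpecialLinearGroup (Fin 2) F) W) :
    finrank k (doublySumZeroMaps ρ (ℙ F (Fin 2 → F)) (ℙ F (Fin 2 → F)))
      = finrank k (sumZeroMaps ρ (ℙ K (Fin 2 → K))) := by
  let S : sumZeroMaps ρ (ℙ K (Fin 2 → K)) →ₗ[k]
      doublySumZeroMaps ρ (ℙ F (Fin 2 → F)) (ℙ F (Fin 2 → F)) :=
    (integralTransform W (pairKernel k)).restrict fun f hf =>
      integralTransform_pairKernel_mem_doublySumZeroMaps (mem_sumZeroMaps.1 hf).1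
  refine (LinearEquiv.ofBijective S
    ⟨fun f f' h => Subtype.ext ?_, fun ⟨d, hd⟩ => ?_⟩).finrank_eq.symm
  · exact integralTransform_pairKernel_injOn (F := F) (k := k) (mem_sumZeroMaps.1 f.2).2
      (mem_sumZeroMaps.1 f'.2).2 (congrArg Subtype.val h)
  · obtain ⟨hd, hleft, hright⟩ := mem_doublySumZeroMaps.1 hd
    obtain ⟨f, hf0, rfl⟩ := exists_integralTransform_pairKernel_eq (K := K) (k := k) hleft hright
    have hback := integralTransform_mem_equivariantMaps (ρ := ρ) (X := ℙ K (Fin 2 → K))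
      (N := fun w p => pairKernel k p w) (fun g w p => pairKernel_smul_smul g p w) hd
    rw [integralTransform_integralTransform sum_pairKernel_mul_pairKernel hf0,
      neg_mem_iff] at hback
    exact ⟨⟨f, mem_sumZeroMaps.2 ⟨hback, hf0⟩⟩, rfl⟩

end QuadraticPoints

section Steinberg

variable {F : Type*} [Field F]

/-- The linear form `v 0 X + v 1 Y`, written as a determinant. -/
def linearForm (v : Fin 2 → F) : MvPolynomial (Fin 2) F :=
  cross ![MvPolynomial.X 1, -MvPolynomial.X 0] fun i => MvPolynomial.C (v i)

theorem linearForm_eq (v : Fin 2 → F) :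
    linearForm v = v 0 • MvPolynomial.X 0 + v 1 • MvPolynomial.X 1 := by
  simp only [linearForm, cross, cons_val_zero, cons_val_one, MvPolynomial.smul_eq_C_mul]
  ring

theorem linearForm_smul (a : F) (v : Fin 2 → F) : linearForm (a • v) = a • linearForm v := by
  simp only [linearForm_eq, Pi.smul_apply, smul_eq_mul, mul_smul, smul_add]

theorem polyRep_linearForm_pow (g : SpecialLinearGroup (Fin 2) F) (v : Fin 2 → F) (n : ℕ) :
    polyRep F g (linearForm v ^ n) = linearForm (g • v) ^ n := by
  refine (map_pow (MvPolynomial.aeval _) (linearForm v) n).trans (congrArg (· ^ n) ?_)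
  simp only [linearForm_eq, map_add, map_smul, MvPolynomial.aeval_X, smul_apply_fin_two]
  module

theorem linearForm_pow_mem (v : Fin 2 → F) (n : ℕ) : linearForm v ^ n ∈ simpleSubmodule F n := by
  rw [linearForm_eq, add_pow]
  refine Submodule.sum_mem _ fun m hm => ?_
  have hterm : (v 0 • MvPolynomial.X 0 : MvPolynomial (Fin 2) F) ^ m
        * (v 1 • MvPolynomial.X 1) ^ (n - m) * ((n.choose m : ℕ) : MvPolynomial (Fin 2) F)
      = (v 0 ^ m * v 1 ^ (n - m)) • (((n.choose m : ℕ) : F) •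
          (MvPolynomial.X 0 ^ m * MvPolynomial.X 1 ^ (n - m))) := by
    simp only [MvPolynomial.smul_eq_C_mul, map_natCast, map_mul, map_pow, mul_pow]
    ring
  rw [hterm]
  exact Submodule.smul_mem _ _ (choose_smul_mem F n m (Finset.mem_range_succ_iff.1 hm))

/-- The evaluation of polynomials at `(-b, a)`, where `(a, b)` represents a given point. -/
def evalOrth (x : ℙ F (Fin 2 → F)) : MvPolynomial (Fin 2) F →ₗ[F] F :=
  (MvPolynomial.aeval ![-x.rep 1, x.rep 0]).toLinearMap

theorem evalOrth_linearForm_pow (x : ℙ F (Fin 2 → F)) (v : Fin 2 → F) (n : ℕ) :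
    evalOrth x (linearForm v ^ n) = cross x.rep v ^ n := by
  simp only [evalOrth, linearForm_eq, AlgHom.toLinearMap_apply, map_pow, map_add, map_smul,
    MvPolynomial.aeval_X, cons_val_zero, cons_val_one, cross, smul_eq_mul]
  ring

variable [Fintype F]

theorem sum_evalOrth_smul_linearForm_pow {s : MvPolynomial (Fin 2) F}
    (hs : s ∈ simpleSubmodule F (Fintype.card F - 1)) :
    ∑ x, evalOrth x s • linearForm x.rep ^ (Fintype.card F - 1) = -s := by
  induction hs using Submodule.span_induction with
  | zero => simp
  | add s t _ _ hs ht => simp only [map_add, add_smul, Finset.sum_add_distrib, hs, ht, neg_add]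
  | smul c s _ hs => simp only [map_smul, smul_assoc, ← Finset.smul_sum, hs, smul_neg]
  | mem s hs =>
    obtain ⟨i, hi, -, rfl⟩ := hs
    have hterm (x : ℙ F (Fin 2 → F)) :
        evalOrth x (MvPolynomial.X 0 ^ i * MvPolynomial.X 1 ^ (Fintype.card F - 1 - i))
            • linearForm x.rep ^ (Fintype.card F - 1)
          = (-1) ^ i * (coords (MvPolynomial (Fin 2) F) x 0 ^ (Fintype.card F - 1 - i)
              * coords (MvPolynomial (Fin 2) F) x 1 ^ i
              * cross ![MvPolynomial.X 1, -MvPolynomial.X 0] (coords _ x)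
                ^ (Fintype.card F - 1)) := by
      unfold coords
      simp only [evalOrth, AlgHom.toLinearMap_apply, map_mul, map_pow, MvPolynomial.aeval_X,
        cons_val_zero, cons_val_one, linearForm, MvPolynomial.algebraMap_eq,
        MvPolynomial.smul_eq_C_mul, neg_pow (x.rep 1), map_neg, map_one]
      ring
    rw [Finset.sum_congr rfl fun x _ => hterm x, ← Finset.mul_sum,
      sum_coords_pow_mul_cross_pow _ (Nat.sub_add_cancel hi), cons_val_zero, cons_val_one,
      cons_val_zero, neg_pow (MvPolynomial.X 0 : MvPolynomial (Fin 2) F)]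
    have hsign : (-1 : MvPolynomial (Fin 2) F) ^ i * (-1) ^ i = 1 := by
      rw [← mul_pow, neg_one_mul, neg_neg, one_pow]
    linear_combination -(MvPolynomial.X 0 ^ i * MvPolynomial.X 1 ^ (Fintype.card F - 1 - i)) * hsign

/-- The vector of the Steinberg module attached to a point of the projective line: the power with
exponent `q - 1` of the linear form of the point, on which the choice of coordinates has no
effect. -/
def pointVector (x : ℙ F (Fin 2 → F)) : simpleSubmodule F (Fintype.card F - 1) :=
  ⟨linearForm x.rep ^ (Fintype.card F - 1), linearForm_pow_mem _ _⟩

theorem steinberg_pointVector (g : SpecialLinearGroup (Fin 2) F) (x : ℙ F (Fin 2 → F)) :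
    steinberg F g (pointVector x) = pointVector (g • x) := by
  obtain ⟨c, hc⟩ := exists_coords_smul (R := F) g x
  have hrep : (g • x).rep = (c : F) • (g • x.rep) := hc
  refine Subtype.ext ((polyRep_linearForm_pow g x.rep _).trans ?_)
  simp only [pointVector, hrep, linearForm_smul, smul_pow,
    FiniteField.pow_card_sub_one_eq_one _ c.ne_zero, one_smul]

theorem sum_pointVector : ∑ x : ℙ F (Fin 2 → F), pointVector x = 0 :=
  Subtype.ext <| (AddSubmonoidClass.coe_finsetSum _ _).trans <|
    sum_cross_pow ![MvPolynomial.X 1, -MvPolynomial.X 0]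

theorem eq_neg_sum_evalOrth_smul_pointVector (s : simpleSubmodule F (Fintype.card F - 1)) :
    s = -∑ x, evalOrth x s.1 • pointVector x := by
  refine Subtype.ext (neg_eq_iff_eq_neg.1 ?_)
  rw [← sum_evalOrth_smul_linearForm_pow s.2, AddSubmonoidClass.coe_finsetSum]
  rfl

variable {V : Type*} [AddCommGroup V] [Module F V]

theorem apply_eq_neg_sum_pointVector
    (φ : simpleSubmodule F (Fintype.card F - 1) →ₗ[F] V)
    (s : simpleSubmodule F (Fintype.card F - 1)) :
    φ s = -∑ x, evalOrth x s.1 • φ (pointVector x) :=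
  (congrArg φ (eq_neg_sum_evalOrth_smul_pointVector s)).trans <| by
    simp only [map_neg, map_sum, map_smul]

theorem exists_apply_pointVector_eq {f : ℙ F (Fin 2 → F) → V} (hf : ∑ x, f x = 0) :
    ∃ φ : simpleSubmodule F (Fintype.card F - 1) →ₗ[F] V, ∀ x, φ (pointVector x) = f x := by
  classical
  refine ⟨-∑ x, ((evalOrth x).comp (Submodule.subtype _)).smulRight (f x), fun x => ?_⟩
  have horth (y : ℙ F (Fin 2 → F)) : evalOrth y (pointVector x).1 = if y = x then 0 else 1 :=
    (evalOrth_linearForm_pow y x.rep _).trans (cross_coords_pow (R := F) y x)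
  have hdelete (y : ℙ F (Fin 2 → F)) :
      (if y = x then (0 : F) else 1) • f y = f y - if y = x then f y else 0 := by
    split_ifs <;> simp
  simp [horth, hdelete, hf]

theorem finrank_intertwiningMap_steinberg
    (ρ : Representation F (SpecialLinearGroup (Fin 2) F) V) :
    finrank F (Representation.IntertwiningMap (steinberg F) ρ)
      = finrank F (sumZeroMaps ρ (ℙ F (Fin 2 → F))) := by
  let restrict : Representation.IntertwiningMap (steinberg F) ρ →ₗ[F]
      sumZeroMaps ρ (ℙ F (Fin 2 → F)) :=
    { toFun φ := ⟨fun x => φ (pointVector x), mem_sumZeroMaps.2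
        ⟨fun g x => by simp only [← steinberg_pointVector, φ.isIntertwining],
          by rw [← map_sum, sum_pointVector, map_zero]⟩⟩
      map_add' _ _ := rfl
      map_smul' _ _ := rfl }
  refine (LinearEquiv.ofBijective restrict ⟨fun φ ψ h => ?_, fun ⟨f, hf⟩ => ?_⟩).finrank_eq
  · have hpoint (x) : φ.toLinearMap (pointVector x) = ψ.toLinearMap (pointVector x) :=
      congrFun (congrArg Subtype.val h) x
    refine Representation.IntertwiningMap.ext (LinearMap.ext fun s => ?_)
    simp only [apply_eq_neg_sum_pointVector _ s, hpoint]
  · obtain ⟨hf, hf0⟩ := mem_sumZeroMaps.1 hf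
    obtain ⟨φ, hφ⟩ := exists_apply_pointVector_eq hf0
    refine ⟨φ.intertwiningMap_of_isIntertwiningMap _ _ fun g s => ?_, Subtype.ext (funext hφ)⟩
    rw [apply_eq_neg_sum_pointVector φ s]
    conv_lhs => rw [eq_neg_sum_evalOrth_smul_pointVector s]
    simp only [map_neg, map_sum, map_smul, steinberg_pointVector, hφ, hf g]

end Steinberg

section ExtendScalars

open scoped TensorProduct

variable {F G V : Type*} (κ : Type*) [Field F] [Field κ] [Algebra F κ] [Group G] [AddCommGroup V]
  [Module F V]

/-- The extension of scalars of a representation. -/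
def extendScalars (ρ : Representation F G V) : Representation κ G (κ ⊗[F] V) where
  toFun g := (ρ g).baseChange κ
  map_one' := by rw [map_one, Module.End.one_eq_id, LinearMap.baseChange_id, Module.End.one_eq_id]
  map_mul' g h := by rw [map_mul, LinearMap.baseChange_mul]

variable {κ}

theorem exists_extendScalars_equiv {ι : Type*} [Finite ι] (b : Basis ι F κ)
    (ρ : Representation F G V) :
    ∃ e : κ ⊗[F] V ≃ₗ[F] (ι → V), ∀ g w i, e (extendScalars κ ρ g w) i = ρ g (e w i) := by
  classical
  refine ⟨TensorProduct.equivFinsuppOfBasisLeft b ≪≫ₗ Finsupp.linearEquivFunOnFinite F V ι,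
    fun g w i => ?_⟩
  induction w with
  | zero => simp
  | add x y hx hy => simp only [map_add, Pi.add_apply, hx, hy]
  | tmul c v => simp [extendScalars]

theorem mem_sumZeroMaps_iff_forall {ι W X k : Type*} [Field k] [Algebra F k] [AddCommGroup W]
    [Module F W] [Module k W] [MulAction G X] [Fintype X] {σ : Representation k G W}
    {ρ : Representation F G V} {e : W ≃ₗ[F] (ι → V)}
    (he : ∀ g w i, e (σ g w) i = ρ g (e w i)) {f : X → W} :
    f ∈ sumZeroMaps σ X ↔ ∀ i, (fun x => e (f x) i) ∈ sumZeroMaps ρ X := by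
  have hsum (i : ι) : ∑ x, e (f x) i = e (∑ x, f x) i := by rw [map_sum, Finset.sum_apply]
  simp only [mem_sumZeroMaps, forall_and, hsum]
  refine and_congr ⟨fun hf i g x => by simp only [hf g x, he], fun hf g x => ?_⟩
    ⟨fun hf i => by rw [hf, map_zero, Pi.zero_apply], fun hf => ?_⟩
  · exact e.injective (funext fun i => (hf i g x).trans (he g (f x) i).symm)
  · exact (map_eq_zero_iff e e.injective).1 (funext hf)

theorem finrank_sumZeroMaps_extendScalars [Module.Finite F κ] [Module.Finite F V]
    (ρ : Representation F G V) (X : Type*) [MulAction G X] [Fintype X] :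
    finrank κ (sumZeroMaps (extendScalars κ ρ) X) = finrank F (sumZeroMaps ρ X) := by
  obtain ⟨e, he⟩ := exists_extendScalars_equiv (finBasis F κ) ρ
  let E : sumZeroMaps (extendScalars κ ρ) X ≃ₗ[F] (Fin (finrank F κ) → sumZeroMaps ρ X) :=
    { toFun f i := ⟨fun x => e (f.1 x) i, (mem_sumZeroMaps_iff_forall he).1 f.2 i⟩
      invFun d := ⟨fun x => e.symm fun i => (d i).1 x, (mem_sumZeroMaps_iff_forall he).2 fun i => by
        simp only [e.apply_symm_apply, (d i).2]⟩
      map_add' f f' := by ext; simp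
      map_smul' c f := by ext; simp
      left_inv f := by ext; simp
      right_inv d := by ext; simp }
  have hE := E.finrank_eq
  have := Module.Free.of_divisionRing κ (sumZeroMaps (extendScalars κ ρ) X)
  rw [← finrank_mul_finrank F κ (sumZeroMaps (extendScalars κ ρ) X), finrank_pi_fintype,
    Finset.sum_const, Finset.card_univ, Fintype.card_fin, smul_eq_mul] at hE
  exact Nat.eq_of_mul_eq_mul_left finrank_pos hE

end ExtendScalars

section Diagonalization

universe u

open Polynomial

variable {κ : Type*} {W : Type u} [Field κ] [AddCommGroup W] [Module κ W] {A : End κ W}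

theorem ker_aeval_prod_le_iSup_eigenspace (A : End κ W) (s : Finset κ) :
    LinearMap.ker (aeval A (∏ μ ∈ s, (X - C μ))) ≤ ⨆ μ ∈ s, A.eigenspace μ := by
  classical
  induction s using Finset.induction_on with
  | empty => simp [Module.End.one_eq_id]
  | insert a s ha ih =>
    have hcoprime : IsCoprime (X - C a) (∏ μ ∈ s, (X - C μ)) :=
      IsCoprime.prod_right fun μ hμ =>
        isCoprime_X_sub_C_of_isUnit_sub (IsUnit.mk0 _ (sub_ne_zero.2 fun h => ha (h ▸ hμ)))
    rw [Finset.prod_insert ha, ← sup_ker_aeval_eq_ker_aeval_mul_of_coprime _ hcoprime,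
      Finset.iSup_insert]
    refine sup_le_sup (le_of_eq ?_) ih
    rw [Module.End.eigenspace_def, map_sub, aeval_X, aeval_C, Algebra.algebraMap_eq_smul_one]

variable [Module.Finite κ W] {n : ℕ} {ζ : κ}

theorem exists_basis_eigenvectors (hn : 0 < n) (hA : A ^ n = 1) (hζ : IsPrimitiveRoot ζ n) :
    ∃ (ι : Type u) (_ : Fintype ι) (b : Basis ι κ W) (μ : ι → κ), ∀ i, A (b i) = μ i • b i := by
  have hspan : ⊤ ≤ Submodule.span κ {v | ∃ μ : κ, A v = μ • v} := by
    have hker : LinearMap.ker (aeval A (X ^ n - 1 : κ[X])) = ⊤ := by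
      rw [map_sub, map_pow, aeval_X, hA, map_one, sub_self, LinearMap.ker_zero]
    rw [← hker, X_pow_sub_one_eq_prod hn hζ]
    refine (ker_aeval_prod_le_iSup_eigenspace A _).trans (iSup₂_le fun μ _ v hv => ?_)
    exact Submodule.subset_span ⟨μ, Module.End.mem_eigenspace_iff.1 hv⟩
  let b := Basis.ofSpan hspan
  choose μ hμ using fun i => Basis.ofSpan_subset hspan ⟨i, rfl⟩
  exact ⟨_, FiniteDimensional.fintypeBasisIndex b, b, μ, hμ⟩

theorem roots_charpoly_of_eigenvectors {ι : Type*} [Fintype ι] (b : Basis ι κ W) {μ : ι → κ}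
    (hμ : ∀ i, A (b i) = μ i • b i) : A.charpoly.roots = Finset.univ.val.map μ := by
  classical
  have hA : A = Matrix.toLin b b (Matrix.diagonal μ) :=
    b.ext fun i => (hμ i).trans (hasEigenvector_toLin_diagonal μ i b).apply_eq_smul.symm
  rw [hA, Matrix.charpoly_toLin, Matrix.charpoly_diagonal]
  exact Polynomial.roots_multiset_prod_X_sub_C (Finset.univ.val.map μ) ▸ by
    rw [Multiset.map_map]; rfl

theorem roots_charpoly_pow (hn : 0 < n) (hA : A ^ n = 1) (hζ : IsPrimitiveRoot ζ n) (j : ℕ) :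
    (A ^ j).charpoly.roots = A.charpoly.roots.map (· ^ j) := by
  obtain ⟨ι, _, b, μ, hμ⟩ := exists_basis_eigenvectors hn hA hζ
  have hpow (i : ι) : (A ^ j) (b i) = μ i ^ j • b i := by
    induction j with
    | zero => simp
    | succ j ih => rw [pow_succ, Module.End.mul_apply, hμ, map_smul, ih, smul_smul, pow_succ']
  rw [roots_charpoly_of_eigenvectors b hpow, roots_charpoly_of_eigenvectors b hμ, Multiset.map_map]
  rfl

theorem pow_eq_one_of_mem_roots_charpoly (hA : A ^ n = 1) {μ : κ} (hμ : μ ∈ A.charpoly.roots) :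
    μ ^ n = 1 := by
  obtain ⟨v, hv⟩ := ((Module.End.hasEigenvalue_iff_isRoot_charpoly A μ).2
    (isRoot_of_mem_roots hμ)).exists_hasEigenvector
  have h := hv.pow_apply n
  rw [hA, Module.End.one_apply] at h
  exact smul_left_injective κ hv.2 (by simpa using h.symm)

theorem finrank_eigenspace_one_eq_count [DecidableEq κ] (hA : A ^ n = 1) (hn : (n : κ) ≠ 0) :
    finrank κ (A.eigenspace 1) = A.charpoly.roots.count 1 := by
  have hsemisimple : A.IsSemisimple := Module.End.isSemisimple_of_squarefree_aeval_eq_zero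
    (X_pow_sub_one_separable_iff.2 hn).squarefree (by simp [hA])
  rw [← hsemisimple.isFinitelySemisimple.maxGenEigenspace_eq_eigenspace,
    LinearMap.finrank_maxGenEigenspace_eq]
  exact (Polynomial.count_roots _).symm

end Diagonalization

section Brauer

variable {κ : Type*} [Field κ]

theorem rootLift_eq_one [Fintype κ] {α : κˣ} {hα : ∀ x : κˣ, x ∈ Subgroup.zpowers α} {ξ : ℂˣ}
    {hξ : IsPrimitiveRoot ξ (Nat.card κˣ)} {x : κˣ} (hx : rootLift α hα ξ hξ x = 1) : x = 1 := by
  classical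
  obtain ⟨j, rfl⟩ := mem_powers_iff_mem_zpowers.2 (hα x)
  have hgen : rootLift α hα ξ hξ α = ξ := MulChar.ofRootOfUnity_spec _ _
  rw [Units.val_pow_eq_pow_val, map_pow, hgen] at hx
  obtain ⟨m, rfl⟩ := hξ.dvd_of_pow_eq_one j (Units.ext (by simpa using hx))
  simp only [pow_mul, pow_card_eq_one', one_pow]

variable {χ : MulChar κ ℂ}

theorem sum_mulChar_pow [DecidableEq κ] (hχ : ∀ x : κˣ, χ x = 1 → x = 1) {x : κ} {n : ℕ}
    (hn : 0 < n) (hx : x ^ n = 1) :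
    ∑ j ∈ Finset.range n, χ (x ^ j) = if x = 1 then (n : ℂ) else 0 := by
  lift x to κˣ using (IsUnit.of_pow_eq_one hx hn.ne')
  split_ifs with hx1
  · simp [hx1]
  · have hne : χ x - 1 ≠ 0 := sub_ne_zero.2 fun h => hx1 (by rw [hχ x h, Units.val_one])
    refine (mul_eq_zero.1 ?_).resolve_right hne
    simp only [map_pow]
    rw [geom_sum_mul, ← map_pow, hx, map_one, sub_self]

theorem sum_multiset_mulChar_pow [DecidableEq κ] (hχ : ∀ x : κˣ, χ x = 1 → x = 1)
    {s : Multiset κ} {n : ℕ} (hn : 0 < n) (hs : ∀ x ∈ s, x ^ n = 1) :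
    ∑ j ∈ Finset.range n, (s.map fun x => χ (x ^ j)).sum = n * s.count 1 := by
  induction s using Multiset.induction_on with
  | empty => simp
  | cons x s ih =>
    simp only [Multiset.map_cons, Multiset.sum_cons, Finset.sum_add_distrib]
    rw [sum_mulChar_pow hχ hn (hs x (s.mem_cons_self x)),
      ih fun y hy => hs y (Multiset.mem_cons_of_mem hy), Multiset.count_cons]
    by_cases hx : x = 1
    · rw [if_pos hx, if_pos hx.symm]
      push_cast
      ring
    · rw [if_neg hx, if_neg (Ne.symm hx), zero_add, add_zero]

variable {F G V : Type*} [Field F] [Algebra F κ] [Group G] [AddCommGroup V] [Module F V]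
  [Module.Finite F V]

theorem brauerCharacter_eq_of_isConj (χ : MulChar κ ℂ) (ρ : Representation F G V) {g h : G}
    (hgh : IsConj g h) : brauerCharacter χ ρ g = brauerCharacter χ ρ h := by
  obtain ⟨c, rfl⟩ := isConj_iff.1 hgh
  let e : V ≃ₗ[F] V := LinearEquiv.ofLinearMap (ρ c) (ρ c⁻¹)
    (by rw [← Module.End.mul_eq_comp, ← map_mul, mul_inv_cancel, map_one, Module.End.one_eq_id])
    (by rw [← Module.End.mul_eq_comp, ← map_mul, inv_mul_cancel, map_one, Module.End.one_eq_id])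
  have hconj : ρ (c * g * c⁻¹) = e.conj (ρ g) := by
    rw [map_mul, map_mul]
    rfl
  rw [brauerCharacter, brauerCharacter, hconj, LinearEquiv.charpoly_conj]

theorem fixedVectors_zpowers {k W : Type*} [Field k] [AddCommGroup W] [Module k W]
    (ρ : Representation k G W) (g : G) :
    fixedVectors ρ (Subgroup.zpowers g) = Module.End.eigenspace (ρ g) 1 := by
  ext w
  rw [Module.End.mem_eigenspace_iff, one_smul]
  exact Representation.mem_invariants_iff_of_forall_mem_zpowers _
    (⟨g, Subgroup.mem_zpowers g⟩ : Subgroup.zpowers g)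
    (fun ⟨_, j, hj⟩ => ⟨j, Subtype.ext hj⟩) w

theorem sum_range_brauerCharacter_pow (hχ : ∀ x : κˣ, χ x = 1 → x = 1)
    (ρ : Representation F G V) {n : ℕ} (hn : 0 < n) {ζ : κ} (hζ : IsPrimitiveRoot ζ n) {g : G}
    (hg : g ^ n = 1) :
    ∑ j ∈ Finset.range n, brauerCharacter χ ρ (g ^ j)
      = n * finrank κ (fixedVectors (extendScalars κ ρ) (Subgroup.zpowers g)) := by
  classical
  have : NeZero n := ⟨hn.ne'⟩
  let A : End κ (TensorProduct F κ V) := extendScalars κ ρ g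
  have hA : A ^ n = 1 := by rw [← map_pow, hg, map_one]
  have hchar (j : ℕ) :
      brauerCharacter χ ρ (g ^ j) = (A.charpoly.roots.map fun μ => χ (μ ^ j)).sum := by
    have hbase : (ρ (g ^ j)).baseChange κ = A ^ j := map_pow (extendScalars κ ρ) g j
    rw [brauerCharacter, ← LinearMap.charpoly_baseChange, hbase, roots_charpoly_pow hn hA hζ,
      Multiset.map_map]
    rfl
  rw [Finset.sum_congr rfl fun j _ => hchar j, sum_multiset_mulChar_pow hχ hn fun μ =>
      pow_eq_one_of_mem_roots_charpoly hA, fixedVectors_zpowers,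
    finrank_eigenspace_one_eq_count hA hζ.neZero'.out]

theorem sum_nthRootsFinset_eq_sum_range {n : ℕ} (hn : 0 < n) {ζ : κ} (hζ : IsPrimitiveRoot ζ n)
    {M : Type*} [AddCommMonoid M] (φ : κ → M) :
    ∑ z ∈ Polynomial.nthRootsFinset n (1 : κ), φ z = ∑ j ∈ Finset.range n, φ (ζ ^ j) := by
  have : NeZero n := ⟨hn.ne'⟩
  refine (Finset.sum_bij (fun j _ => ζ ^ j) (fun j _ => ?_) (fun i hi j hj h => ?_)
    (fun x hx => ?_) fun j _ => rfl).symm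
  · rw [Polynomial.mem_nthRootsFinset hn, ← pow_mul, mul_comm, pow_mul, hζ.pow_eq_one, one_pow]
  · exact hζ.pow_inj (Finset.mem_range.1 hi) (Finset.mem_range.1 hj) h
  · obtain ⟨j, hj, h⟩ :=
      hζ.eq_pow_of_pow_eq_one ((Polynomial.mem_nthRootsFinset hn 1).1 hx)
    exact ⟨j, Finset.mem_range.2 hj, h⟩

theorem sum_brauerCharacter_eq (hχ : ∀ x : κˣ, χ x = 1 → x = 1) (ρ : Representation F G V)
    {n : ℕ} (hn : 0 < n) {ζ : κ} (hζ : IsPrimitiveRoot ζ n) {g : G} (hg : g ^ n = 1) {f : κ → G}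
    (hf : ∀ j, IsConj (f (ζ ^ j)) (g ^ j)) :
    ∑ z ∈ Polynomial.nthRootsFinset n (1 : κ), brauerCharacter χ ρ (f z)
      = n * finrank κ (fixedVectors (extendScalars κ ρ) (Subgroup.zpowers g)) := by
  rw [sum_nthRootsFinset_eq_sum_range hn hζ, ← sum_range_brauerCharacter_pow hχ ρ hn hζ hg]
  exact Finset.sum_congr rfl fun j _ => brauerCharacter_eq_of_isConj χ ρ (hf j)

end Brauer

section TorusMatrix

variable {F K κ : Type*} [Field F] [Field K] [Algebra F K] [Field κ] [Algebra F κ] [Algebra K κ]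
  [IsScalarTower F K κ]

theorem torusMatrix_one : torusMatrix F (1 : K) = 1 := if_pos rfl

theorem torusMatrix_neg_one : torusMatrix F (-1 : K) = -1 := by
  by_cases h : (-1 : K) = 1
  · have hF : (-1 : F) = 1 := (algebraMap F K).injective (by simpa using h)
    rw [h, torusMatrix_one]
    ext i j
    fin_cases i <;> fin_cases j <;> simp [hF]
  · exact (if_neg h).trans (if_pos rfl)

theorem coe_torusMatrix {ζ : K} (h1 : ζ ≠ 1) (h2 : ζ ≠ -1) :
    (torusMatrix F ζ).1 = !![0, -1; 1, torusTrace F ζ] :=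
  congrArg Subtype.val ((if_neg h1).trans (if_neg h2))

theorem torusTrace_algebraMap (ζ : K) : torusTrace F (algebraMap K κ ζ) = torusTrace F ζ := by
  have htrace : (fun b => algebraMap F κ b = algebraMap K κ ζ + (algebraMap K κ ζ)⁻¹)
      = fun b => algebraMap F K b = ζ + ζ⁻¹ := by
    ext b
    rw [IsScalarTower.algebraMap_apply F K κ, ← map_inv₀, ← map_add,
      (algebraMap K κ).injective.eq_iff]
  unfold torusTrace
  congr! 2

theorem torusMatrix_algebraMap (ζ : K) : torusMatrix F (algebraMap K κ ζ) = torusMatrix F ζ := by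
  have hinj := (algebraMap K κ).injective
  have hone : algebraMap K κ ζ = 1 ↔ ζ = 1 := map_eq_one_iff _ hinj
  have hneg : algebraMap K κ ζ = -1 ↔ ζ = -1 := by rw [← hinj.eq_iff, map_neg, map_one]
  grind [torusMatrix, torusTrace_algebraMap]

theorem torusTrace_self (a : F) : torusTrace F a = a + a⁻¹ := by
  have h : ∃ b : F, algebraMap F F b = a + a⁻¹ := ⟨_, rfl⟩
  rw [torusTrace, dif_pos h]
  exact h.choose_spec

end TorusMatrix

section Split

variable {F : Type*} [Field F]

/-- The homomorphism `a ↦ diag(a, a⁻¹)` onto the diagonal torus of `SL₂(F)`. -/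
def splitTorus : Fˣ →* SpecialLinearGroup (Fin 2) F where
  toFun a := SpecialLinearGroup.diag2 a a.ne_zero
  map_one' := by
    ext i j
    fin_cases i <;> fin_cases j <;> simp [SpecialLinearGroup.diag2_coe']
  map_mul' a b := by
    ext i j
    fin_cases i <;> fin_cases j <;> simp [SpecialLinearGroup.diag2_coe', mul_comm]

theorem coe_splitTorus (a : Fˣ) : (splitTorus a).1 = !![(a : F), 0; 0, (a : F)⁻¹] :=
  SpecialLinearGroup.diag2_coe' a.ne_zero

theorem isConj_torusMatrix_splitTorus (a : Fˣ) : IsConj (torusMatrix F (a : F)) (splitTorus a) := by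
  by_cases h1 : (a : F) = 1
  · rw [h1, torusMatrix_one, show a = 1 from Units.ext h1, map_one]
  by_cases h2 : (a : F) = -1
  · have hneg : splitTorus a = -1 := by
      ext i j
      fin_cases i <;> fin_cases j <;> simp [coe_splitTorus, h2]
    rw [h2, torusMatrix_neg_one, hneg]
  have hne : 1 - (a : F) ^ 2 ≠ 0 :=
    sub_ne_zero.2 fun h => (sq_eq_one_iff.1 h.symm).elim h1 h2
  let c : F := a / (1 - (a : F) ^ 2)
  -- the rows are left eigenvectors of `torusMatrix F a` for the eigenvalues `a` and `a⁻¹`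
  let P : SpecialLinearGroup (Fin 2) F := ⟨!![1, (a : F); c, c * (a : F)⁻¹], by
    rw [det_fin_two_of]
    simp only [c]
    field_simp⟩
  refine isConj_iff.2 ⟨P, mul_inv_eq_iff_eq_mul.2 ?_⟩
  refine Subtype.ext (show P.1 * (torusMatrix F (a : F)).1 = (splitTorus a).1 * P.1 from ?_)
  rw [coe_torusMatrix h1 h2, torusTrace_self, coe_splitTorus]
  ext i j
  fin_cases i <;> fin_cases j <;> simp [P, mul_apply, Fin.sum_univ_two] <;> field_simp <;> ring

variable (F) in
/-- The pair of points `(1 : 0)` and `(0 : 1)` of the projective line. -/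
def coordinatePoints : ℙ F (Fin 2 → F) × ℙ F (Fin 2 → F) :=
  (.mk F (Pi.single 0 1) (by simp), .mk F (Pi.single 1 1) (by simp))

theorem coordinatePoints_fst_ne_snd : (coordinatePoints F).1 ≠ (coordinatePoints F).2 := by
  rw [coordinatePoints, Ne, mk_eq_mk_iff_cross]
  simp [cross]

theorem mem_orbit_coordinatePoints {p : ℙ F (Fin 2 → F) × ℙ F (Fin 2 → F)} (hp : p.1 ≠ p.2) :
    p ∈ MulAction.orbit (SpecialLinearGroup (Fin 2) F) (coordinatePoints F) := by
  have htwo : MulAction.IsMultiplyPretransitive (SpecialLinearGroup (Fin 2) F)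
    (ℙ F (Fin 2 → F)) 2 := inferInstance
  obtain ⟨g, h1, h2⟩ := MulAction.is_two_pretransitive_iff.1 htwo coordinatePoints_fst_ne_snd hp
  exact ⟨g, Prod.ext h1 h2⟩

theorem stabilizer_coordinatePoints :
    MulAction.stabilizer (SpecialLinearGroup (Fin 2) F) (coordinatePoints F)
      = splitTorus.range := by
  ext g
  have hdiag : g ∈ MulAction.stabilizer _ (coordinatePoints F) ↔ g.1 1 0 = 0 ∧ g.1 0 1 = 0 := by
    simp [MulAction.mem_stabilizer_iff, coordinatePoints, Prod.ext_iff, Projectivization.smul_mk,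
      mk_eq_mk_iff_cross, cross, smul_apply_fin_two]
  rw [hdiag]
  constructor
  · rintro ⟨h10, h01⟩
    have hdet := g.2
    rw [det_fin_two, h10, mul_zero, sub_zero] at hdet
    have hinv : (g.1 0 0)⁻¹ = g.1 1 1 := (eq_inv_of_mul_eq_one_right hdet).symm
    refine ⟨Units.mkOfMulEqOne _ _ hdet, ?_⟩
    ext i j
    fin_cases i <;> fin_cases j <;> simp [coe_splitTorus, h10, h01, hinv]
  · rintro ⟨a, rfl⟩
    simp [coe_splitTorus]

end Split

section RationalPoints

variable {F K : Type*} [Field F] [Field K] [Algebra F K]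

variable (F K) in
/-- The extension of scalars `F² → K²`. -/
def extendCoordinates : (Fin 2 → F) →ₛₗ[algebraMap F K] (Fin 2 → K) where
  toFun v := algebraMap F K ∘ v
  map_add' v w := by ext; simp
  map_smul' a v := by ext; simp

theorem extendCoordinates_injective : Function.Injective (extendCoordinates F K) :=
  (algebraMap F K).injective.comp_left

variable [Fact (finrank F K = 2)]

theorem smul_mk_eq_mk_iff {g : SpecialLinearGroup (Fin 2) F} {v w : Fin 2 → K} (hv : v ≠ 0)
    (hw : w ≠ 0) : g • Projectivization.mk K v hv = Projectivization.mk K w hw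
      ↔ ∃ c : K, c • w = SpecialLinearGroup.map (algebraMap F K) g • v :=
  Projectivization.mk_eq_mk_iff' ..

variable (F K) in
/-- The inclusion of the points over `F` into the projective line over the quadratic extension `K`
of `F`. -/
def rationalPoints : ℙ F (Fin 2 → F) →[SpecialLinearGroup (Fin 2) F] ℙ K (Fin 2 → K) where
  toFun := Projectivization.map (extendCoordinates F K) extendCoordinates_injective
  map_smul' g x := by
    induction x using Projectivization.ind with | h v hv =>
    refine ((smul_mk_eq_mk_iff _ _).2 ⟨1, funext fun i => ?_⟩).symm
    rw [one_smul]
    exact (algebraMap F K).map_mulVec g.1 v i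

theorem rationalPoints_mk {v : Fin 2 → F} (hv : v ≠ 0) :
    rationalPoints F K (.mk F v hv) = .mk K (extendCoordinates F K v)
      ((map_ne_zero_iff _ extendCoordinates_injective).2 hv) := rfl

theorem rationalPoints_injective : Function.Injective (rationalPoints F K) := by
  intro x y h
  induction x using Projectivization.ind with | h v hv =>
  induction y using Projectivization.ind with | h w hw =>
  rw [rationalPoints_mk, rationalPoints_mk, mk_eq_mk_iff_cross] at h
  rw [mk_eq_mk_iff_cross]
  exact (algebraMap F K).injective (by simpa [cross, extendCoordinates] using h)

theorem mk_mem_range_rationalPoints_of_det_eq_zero {M : Matrix (Fin 2) (Fin 2) F} (hM : M.det = 0)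
    {v : Fin 2 → K} (hv : M.map (algebraMap F K) *ᵥ v ≠ 0) :
    Projectivization.mk K _ hv ∈ Set.range (rationalPoints F K) := by
  obtain ⟨u, hu0, hu⟩ := exists_vecMul_eq_zero_iff.2 hM
  have horth : (algebraMap F K ∘ u) ⬝ᵥ M.map (algebraMap F K) *ᵥ v = 0 := by
    have hvec : (algebraMap F K ∘ u) ᵥ* M.map (algebraMap F K) = 0 := by
      ext i
      rw [← RingHom.map_vecMul, hu, Pi.zero_apply, map_zero, Pi.zero_apply]
    rw [dotProduct_mulVec, hvec, zero_dotProduct]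
  have hw : ![-u 1, u 0] ≠ 0 := fun h => hu0 (by
    ext i
    fin_cases i
    exacts [congrFun h 1, neg_eq_zero.1 (congrFun h 0)])
  refine ⟨.mk F _ hw, ?_⟩
  rw [rationalPoints_mk, mk_eq_mk_iff_cross]
  simp only [dotProduct, Fin.sum_univ_two, Function.comp_apply] at horth
  simp only [cross, extendCoordinates, LinearMap.coe_mk, AddHom.coe_mk, Function.comp_apply,
    cons_val_zero, cons_val_one, map_neg]
  linear_combination -horth

end RationalPoints

section Nonsplit

theorem cross_smul_pow_smul {R : Type*} [CommRing R] (c : R) (v : Fin 2 → R) (n : ℕ) :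
    cross (c • v) ((c • v) ^ n) = c ^ (n + 1) * cross v (v ^ n) := by
  rw [_root_.smul_pow, cross_smul_left, cross_smul_right, pow_succ', mul_assoc]

variable {F K : Type*} [Field F] [Field K] [Algebra F K]

/-- The vector `(1, -ζ)`, an eigenvector of `torusMatrix F ζ` for the eigenvalue `ζ`. -/
def eigenVector (ζ : K) : Fin 2 → K := ![1, -ζ]

theorem eigenVector_ne_zero (ζ : K) : eigenVector ζ ≠ 0 := fun h =>
  one_ne_zero (congrFun h 0)

theorem map_mulVec_eigenVector_injective {ζ : K} (hζ : ζ ∉ Set.range (algebraMap F K)) :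
    Function.Injective fun M : Matrix (Fin 2) (Fin 2) F =>
      M.map (algebraMap F K) *ᵥ eigenVector ζ := by
  intro M N h
  have hrow (i : Fin 2) : algebraMap F K (M i 0) - algebraMap F K (M i 1) * ζ
      = algebraMap F K (N i 0) - algebraMap F K (N i 1) * ζ := by
    simpa [eigenVector, mulVec, dotProduct, Fin.sum_univ_two, sub_eq_add_neg] using congrFun h i
  have h1 (i : Fin 2) : M i 1 = N i 1 := by
    by_contra hne
    refine hζ ⟨(M i 0 - N i 0) / (M i 1 - N i 1), ?_⟩
    rw [map_div₀, div_eq_iff ((map_ne_zero _).2 (sub_ne_zero.2 hne)), map_sub, map_sub]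
    linear_combination hrow i
  have h0 (i : Fin 2) : M i 0 = N i 0 :=
    (algebraMap F K).injective (by simpa [h1] using hrow i)
  ext i j
  fin_cases j
  exacts [h0 i, h1 i]

/-- The point `(1 : -ζ)` of the projective line over `K`. -/
def eigenPoint (ζ : K) : ℙ K (Fin 2 → K) := .mk K (eigenVector ζ) (eigenVector_ne_zero ζ)

theorem eigenPoint_notMem_range_rationalPoints [Fact (finrank F K = 2)] {ζ : K}
    (hζ : ζ ∉ Set.range (algebraMap F K)) : eigenPoint ζ ∉ Set.range (rationalPoints F K) := by
  rintro ⟨x, hx⟩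
  induction x using Projectivization.ind with | h v hv =>
  rw [rationalPoints_mk, eigenPoint, mk_eq_mk_iff_cross] at hx
  have hcross : algebraMap F K (v 0) * -ζ - algebraMap F K (v 1) = 0 := by
    simpa [cross, extendCoordinates, eigenVector] using hx
  have hv0 : v 0 ≠ 0 := by
    intro h0
    refine hv (funext fun i => ?_)
    fin_cases i
    exacts [h0, by simpa [h0] using hcross]
  refine hζ ⟨-v 1 / v 0, ?_⟩
  rw [map_div₀, div_eq_iff ((map_ne_zero _).2 hv0), map_neg]
  linear_combination hcross

theorem eq_of_smul_eigenVector_eq {ζ : K} (hζ : ζ ∉ Set.range (algebraMap F K))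
    {g h : SpecialLinearGroup (Fin 2) F}
    (hgh : SpecialLinearGroup.map (algebraMap F K) g • eigenVector ζ
      = SpecialLinearGroup.map (algebraMap F K) h • eigenVector ζ) : g = h :=
  Subtype.ext (map_mulVec_eigenVector_injective hζ hgh)

theorem map_mulVec_eigenVector_surjective [Finite F] [Finite K]
    [Fact (finrank F K = 2)] {ζ : K} (hζ : ζ ∉ Set.range (algebraMap F K)) :
    Function.Surjective fun M : Matrix (Fin 2) (Fin 2) F =>
      M.map (algebraMap F K) *ᵥ eigenVector ζ := by
  have := Fintype.ofFinite F
  have := Fintype.ofFinite K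
  refine ((Fintype.bijective_iff_injective_and_card _).2
    ⟨map_mulVec_eigenVector_injective hζ, ?_⟩).2
  rw [← Nat.card_eq_fintype_card, ← Nat.card_eq_fintype_card]
  simp [Matrix, card_quadratic (F := F) (K := K), ← pow_mul]

theorem map_torusMatrix_neg_one_smul (v : Fin 2 → K) :
    SpecialLinearGroup.map (algebraMap F K) (torusMatrix F (-1 : K)) • v = -v := by
  rw [torusMatrix_neg_one]
  ext i
  fin_cases i <;> simp [smul_apply_fin_two]

variable [Fintype F]

theorem eq_one_or_eq_neg_one_of_pow_card_add_one {ζ : K} (hζ : ζ ^ (Fintype.card F + 1) = 1)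
    (h : ζ ∈ Set.range (algebraMap F K)) : ζ = 1 ∨ ζ = -1 := by
  obtain ⟨a, rfl⟩ := h
  rw [pow_succ, ← map_pow, FiniteField.pow_card] at hζ
  exact mul_self_eq_one_iff.1 hζ

theorem notMem_range_algebraMap {ζ : K} (hζ : IsPrimitiveRoot ζ (Fintype.card F + 1)) :
    ζ ∉ Set.range (algebraMap F K) := by
  intro h
  have hsq : ζ ^ 2 = 1 := sq_eq_one_iff.2 (eq_one_or_eq_neg_one_of_pow_card_add_one hζ.pow_eq_one h)
  have hle := Nat.le_of_dvd two_pos (hζ.dvd_of_pow_eq_one 2 hsq)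
  have hF : 1 < Fintype.card F := Fintype.one_lt_card
  omega

theorem cross_pow_card_mulVec (M : Matrix (Fin 2) (Fin 2) F) (v : Fin 2 → K) :
    cross (M.map (algebraMap F K) *ᵥ v) ((M.map (algebraMap F K) *ᵥ v) ^ Fintype.card F)
      = algebraMap F K M.det * cross v (v ^ Fintype.card F) := by
  have hfrob : (M.map (algebraMap F K) *ᵥ v) ^ Fintype.card F
      = M.map (algebraMap F K) *ᵥ v ^ Fintype.card F := by
    ext i
    simp only [Pi.pow_apply, mulVec, dotProduct, map_apply, ← sum_pow_card F, mul_pow, ← map_pow,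
      FiniteField.pow_card]
  rw [hfrob, cross_mulVec, RingHom.map_det, RingHom.mapMatrix_apply]

theorem cross_pow_card_eigenVector_ne_zero {ζ : K} (hζ : IsPrimitiveRoot ζ (Fintype.card F + 1)) :
    cross (eigenVector ζ) (eigenVector ζ ^ Fintype.card F) ≠ 0 := by
  intro h
  have hfix : ζ ^ Fintype.card F = ζ := by
    have hζ' : -ζ ^ Fintype.card F + ζ = 0 := by
      simpa [cross, eigenVector, neg_pow_card F] using h
    linear_combination -hζ'
  have := hζ.pow_eq_one
  rw [pow_succ, hfix] at this
  rcases mul_self_eq_one_iff.1 this with rfl | rfl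
  · exact notMem_range_algebraMap hζ ⟨1, map_one _⟩
  · exact notMem_range_algebraMap hζ ⟨-1, by simp⟩

theorem pow_card_add_one_of_mulVec_eigenVector {ζ c : K}
    (hζ : IsPrimitiveRoot ζ (Fintype.card F + 1)) {M : Matrix (Fin 2) (Fin 2) F}
    (hM : M.map (algebraMap F K) *ᵥ eigenVector ζ = c • eigenVector ζ) :
    c ^ (Fintype.card F + 1) = algebraMap F K M.det := by
  have hcross := cross_pow_card_mulVec M (eigenVector ζ)
  rw [hM, cross_smul_pow_smul] at hcross
  exact mul_right_cancel₀ (cross_pow_card_eigenVector_ne_zero hζ) hcross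

theorem exists_pow_card_add_one_eq [Finite K] [Fact (finrank F K = 2)] (a : F) :
    ∃ c : K, c ^ (Fintype.card F + 1) = algebraMap F K a := by
  have := Fintype.ofFinite K
  obtain ⟨c, rfl⟩ := FiniteField.norm_surjective F K a
  have hF : 0 < Fintype.card F - 1 := Nat.sub_pos_of_lt Fintype.one_lt_card
  have hexp : (Fintype.card F ^ 2 - 1) / (Fintype.card F - 1) = Fintype.card F + 1 := by
    rw [← one_pow 2, Nat.sq_sub_sq, one_pow, Nat.mul_div_cancel _ hF]
  refine ⟨c, ?_⟩
  rw [FiniteField.algebraMap_norm_eq_pow, Nat.card_eq_fintype_card, Nat.card_eq_fintype_card,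
    card_quadratic (F := F) (K := K), hexp]

theorem mem_orbit_eigenPoint [Finite K] [Fact (finrank F K = 2)] {ζ : K}
    (hζ : IsPrimitiveRoot ζ (Fintype.card F + 1)) {p : ℙ K (Fin 2 → K)}
    (hp : p ∉ Set.range (rationalPoints F K)) :
    p ∈ MulAction.orbit (SpecialLinearGroup (Fin 2) F) (eigenPoint ζ) := by
  have hsurj (w : Fin 2 → K) : ∃ M : Matrix (Fin 2) (Fin 2) F,
      M.map (algebraMap F K) *ᵥ eigenVector ζ = w :=
    map_mulVec_eigenVector_surjective (notMem_range_algebraMap hζ) w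
  induction p using Projectivization.ind with | h v hv =>
  obtain ⟨M, rfl⟩ := hsurj v
  have hdet : M.det ≠ 0 := fun h => hp (mk_mem_range_rationalPoints_of_det_eq_zero h hv)
  obtain ⟨c, hc⟩ := exists_pow_card_add_one_eq (K := K) M.det⁻¹
  obtain ⟨N, hN⟩ := hsurj (c • (M.map (algebraMap F K) *ᵥ eigenVector ζ))
  have hNdet : N.det = 1 := by
    refine (algebraMap F K).injective
      (mul_right_cancel₀ (cross_pow_card_eigenVector_ne_zero hζ) ?_)
    rw [← cross_pow_card_mulVec, hN, cross_smul_pow_smul, cross_pow_card_mulVec, hc, ← mul_assoc,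
      ← map_mul, inv_mul_cancel₀ hdet]
  exact ⟨⟨N, hNdet⟩, (smul_mk_eq_mk_iff _ _).2 ⟨c, hN.symm⟩⟩

variable [Finite K]

theorem map_torusMatrix_smul_eigenVector {ζ : K} (hζ : ζ ^ (Fintype.card F + 1) = 1) :
    SpecialLinearGroup.map (algebraMap F K) (torusMatrix F ζ) • eigenVector ζ
      = ζ • eigenVector ζ := by
  have := Fintype.ofFinite K
  by_cases h1 : ζ = 1
  · rw [h1, torusMatrix_one, map_one, one_smul, one_smul]
  by_cases h2 : ζ = -1
  · rw [h2, map_torusMatrix_neg_one_smul, neg_one_smul]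
  have h0 : ζ ≠ 0 := fun h => by simp [h] at hζ
  ext i
  rw [smul_apply_fin_two, SpecialLinearGroup.map_apply_coe, coe_torusMatrix h1 h2]
  fin_cases i
  · simp [eigenVector]
  · simp [eigenVector, algebraMap_torusTrace ζ (Or.inr hζ)]
    field_simp
    ring

theorem map_torusMatrix_pow_smul_eigenVector {ζ : K} (hζ : ζ ^ (Fintype.card F + 1) = 1) (j : ℕ) :
    SpecialLinearGroup.map (algebraMap F K) (torusMatrix F ζ ^ j) • eigenVector ζ
      = ζ ^ j • eigenVector ζ := by
  induction j with
  | zero => rw [pow_zero, map_one, one_smul, pow_zero, one_smul]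
  | succ j ih =>
    rw [pow_succ, map_mul, mul_smul, map_torusMatrix_smul_eigenVector hζ, smul_comm, ih, smul_smul,
      pow_succ']

theorem torusMatrix_pow_card_add_one {ζ : K} (hζ : IsPrimitiveRoot ζ (Fintype.card F + 1)) :
    torusMatrix F ζ ^ (Fintype.card F + 1) = 1 :=
  eq_of_smul_eigenVector_eq (notMem_range_algebraMap hζ) (by
    rw [map_torusMatrix_pow_smul_eigenVector hζ.pow_eq_one, hζ.pow_eq_one, map_one, one_smul,
      one_smul])

variable [Fact (finrank F K = 2)]

theorem stabilizer_eigenPoint {ζ : K} (hζ : IsPrimitiveRoot ζ (Fintype.card F + 1)) :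
    MulAction.stabilizer (SpecialLinearGroup (Fin 2) F) (eigenPoint ζ)
      = Subgroup.zpowers (torusMatrix F ζ) := by
  refine le_antisymm (fun g hg => ?_) (Subgroup.zpowers_le.2 ?_)
  · obtain ⟨c, hc⟩ := (smul_mk_eq_mk_iff _ _).1 (MulAction.mem_stabilizer_iff.1 hg)
    have hcpow := pow_card_add_one_of_mulVec_eigenVector (M := g.1) hζ hc.symm
    rw [g.2, map_one] at hcpow
    obtain ⟨j, -, rfl⟩ := hζ.eq_pow_of_pow_eq_one hcpow
    have hg : g = torusMatrix F ζ ^ j := eq_of_smul_eigenVector_eq (notMem_range_algebraMap hζ)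
      (by rw [map_torusMatrix_pow_smul_eigenVector hζ.pow_eq_one, hc])
    exact hg ▸ Subgroup.npow_mem_zpowers _ j
  · exact (smul_mk_eq_mk_iff _ _).2 ⟨ζ, (map_torusMatrix_smul_eigenVector hζ.pow_eq_one).symm⟩

theorem isConj_torusMatrix_pow {ζ : K} (hζ : IsPrimitiveRoot ζ (Fintype.card F + 1)) (j : ℕ) :
    IsConj (torusMatrix F (ζ ^ j)) (torusMatrix F ζ ^ j) := by
  have hroot : (ζ ^ j) ^ (Fintype.card F + 1) = 1 := by rw [pow_right_comm, hζ.pow_eq_one, one_pow]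
  have hpow := map_torusMatrix_pow_smul_eigenVector hζ.pow_eq_one j
  by_cases hF : ζ ^ j ∈ Set.range (algebraMap F K)
  · have heq : torusMatrix F (ζ ^ j) = torusMatrix F ζ ^ j := by
      refine eq_of_smul_eigenVector_eq (notMem_range_algebraMap hζ) ?_
      rw [hpow]
      rcases eq_one_or_eq_neg_one_of_pow_card_add_one hroot hF with h | h
      · rw [h, torusMatrix_one, map_one, one_smul, one_smul]
      · rw [h, map_torusMatrix_neg_one_smul, neg_one_smul]
    rw [heq]
  obtain ⟨g, hg⟩ := mem_orbit_eigenPoint hζ (eigenPoint_notMem_range_rationalPoints hF)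
  obtain ⟨c, hc⟩ := (smul_mk_eq_mk_iff _ _).1 hg
  refine isConj_iff.2 ⟨g⁻¹, eq_of_smul_eigenVector_eq (notMem_range_algebraMap hζ) ?_⟩
  rw [inv_inv, map_mul, map_mul, mul_smul, mul_smul, ← hc, smul_comm _ c,
    map_torusMatrix_smul_eigenVector hroot, smul_comm c, hc, smul_comm _ (ζ ^ j), map_inv,
    inv_smul_smul, hpow]

end Nonsplit

section Counting

variable {F : Type*} [Field F]

variable (F) in
/-- The diagonal embedding of the projective line. -/
def diagonalPoints : ℙ F (Fin 2 → F) →[SpecialLinearGroup (Fin 2) F]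
    ℙ F (Fin 2 → F) × ℙ F (Fin 2 → F) where
  toFun x := (x, x)
  map_smul' _ _ := rfl

theorem mem_range_diagonalPoints_iff {p : ℙ F (Fin 2 → F) × ℙ F (Fin 2 → F)} :
    p ∈ Set.range (diagonalPoints F) ↔ p.1 = p.2 :=
  ⟨fun ⟨_, h⟩ => h ▸ rfl, fun h => ⟨p.1, Prod.ext rfl h⟩⟩

variable [Fintype F] {k W : Type*} [Field k] [Algebra F k] [AddCommGroup W] [Module k W]
  [Module.Finite k W]

theorem finrank_fixedVectors_stabilizer_coordinatePoints
    (ρ : Representation k (SpecialLinearGroup (Fin 2) F) W) :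
    finrank k (fixedVectors ρ (MulAction.stabilizer _ (coordinatePoints F)))
      = finrank k (sumZeroMaps ρ (ℙ F (Fin 2 → F)))
        + finrank k (doublySumZeroMaps ρ (ℙ F (Fin 2 → F)) (ℙ F (Fin 2 → F))) := by
  have hcard : (Fintype.card (ℙ F (Fin 2 → F)) : k) ≠ 0 := by
    rw [cast_card_projectiveLine]
    exact one_ne_zero
  have horbit := finrank_equivariantMaps_of_range_union_orbit ρ (i := diagonalPoints F)
    (fun _ _ h => congrArg Prod.fst h)
    (fun h => coordinatePoints_fst_ne_snd (mem_range_diagonalPoints_iff.1 h))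
    (fun _ hp => mem_orbit_coordinatePoints fun h => hp (mem_range_diagonalPoints_iff.2 h))
  have hprod := finrank_equivariantMaps_prod ρ hcard hcard
  omega

variable {K : Type*} [Field K] [Algebra F K] [Fact (finrank F K = 2)] [Algebra K k]

theorem finrank_sumZeroMaps_quadratic [Fintype K]
    (ρ : Representation k (SpecialLinearGroup (Fin 2) F) W)
    {ζ : K} (hζ : IsPrimitiveRoot ζ (Fintype.card F + 1)) :
    finrank k (sumZeroMaps ρ (ℙ K (Fin 2 → K)))
      = finrank k (sumZeroMaps ρ (ℙ F (Fin 2 → F)))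
        + finrank k (fixedVectors ρ (MulAction.stabilizer _ (eigenPoint ζ))) := by
  have horbit := finrank_equivariantMaps_of_range_union_orbit ρ (i := rationalPoints F K)
    rationalPoints_injective
    (eigenPoint_notMem_range_rationalPoints (notMem_range_algebraMap hζ))
    (fun _ hp => mem_orbit_eigenPoint hζ hp)
  have hF := finrank_equivariantMaps_eq_invariants_add (X := ℙ F (Fin 2 → F)) ρ
    (by rw [cast_card_projectiveLine]; exact one_ne_zero)
  have hK := finrank_equivariantMaps_eq_invariants_add (X := ℙ K (Fin 2 → K)) ρ
    (by rw [cast_card_projectiveLine]; exact one_ne_zero)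
  omega

theorem finrank_fixedVectors_coordinatePoints_eq_eigenPoint_add [Finite K] [IsScalarTower F K k]
    (ρ : Representation k (SpecialLinearGroup (Fin 2) F) W)
    {ζ : K} (hζ : IsPrimitiveRoot ζ (Fintype.card F + 1)) :
    finrank k (fixedVectors ρ (MulAction.stabilizer _ (coordinatePoints F)))
      = finrank k (fixedVectors ρ (MulAction.stabilizer _ (eigenPoint ζ)))
        + 2 * finrank k (sumZeroMaps ρ (ℙ F (Fin 2 → F))) := by
  have := Fintype.ofFinite K
  rw [finrank_fixedVectors_stabilizer_coordinatePoints,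
    finrank_doublySumZeroMaps_eq_finrank_sumZeroMaps (K := K), finrank_sumZeroMaps_quadratic ρ hζ]
  ring

end Counting

theorem exists_isPrimitiveRoot (L : Type*) [Field L] [Fintype L] {n : ℕ}
    (hn : n ∣ Fintype.card L - 1) : ∃ ζ : L, IsPrimitiveRoot ζ n := by
  obtain ⟨u, hu⟩ := IsCyclic.exists_generator (α := Lˣ)
  have h := IsPrimitiveRoot.orderOf u
  rw [orderOf_eq_card_of_forall_mem_zpowers hu, Nat.card_units, Nat.card_eq_fintype_card] at h
  obtain ⟨m, hm⟩ := hn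
  have hL : 0 < Fintype.card L - 1 := Nat.sub_pos_of_lt Fintype.one_lt_card
  exact ⟨((u ^ m : Lˣ) : L), (h.pow hL (by rw [hm, mul_comm])).map_of_injective
    (f := Units.coeHom L) Units.val_injective⟩

section TorusSums

variable {F κ V : Type*} [Field F] [Fintype F] [Field κ] [Algebra F κ]
  [AddCommGroup V] [Module F V] [Module.Finite F V] {χ : MulChar κ ℂ}

theorem sum_brauerCharacter_split (hχ : ∀ x : κˣ, χ x = 1 → x = 1)
    (ρ : Representation F (SpecialLinearGroup (Fin 2) F) V) :
    ∑ z ∈ Polynomial.nthRootsFinset (Fintype.card F - 1) (1 : κ),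
        brauerCharacter χ ρ (torusMatrix F z)
      = (Fintype.card F - 1 : ℕ) * finrank κ (fixedVectors (extendScalars κ ρ)
          (MulAction.stabilizer _ (coordinatePoints F))) := by
  obtain ⟨ζ, hζ⟩ := exists_isPrimitiveRoot F dvd_rfl
  have hpos : 0 < Fintype.card F - 1 := Nat.sub_pos_of_lt Fintype.one_lt_card
  obtain ⟨u, rfl⟩ := hζ.isUnit hpos.ne'
  have hu : IsPrimitiveRoot u (Fintype.card F - 1) := IsPrimitiveRoot.coe_units_iff.1 hζ
  have hrange : (splitTorus (F := F)).range = Subgroup.zpowers (splitTorus u) := by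
    have htop : Subgroup.zpowers u = ⊤ := by
      rw [← Subgroup.card_eq_iff_eq_top, Nat.card_zpowers, ← hu.eq_orderOf, Nat.card_units,
        Nat.card_eq_fintype_card]
    rw [MonoidHom.range_eq_map, ← htop, MonoidHom.map_zpowers]
  rw [stabilizer_coordinatePoints, hrange]
  refine sum_brauerCharacter_eq hχ ρ hpos (hζ.map_of_injective (algebraMap F κ).injective)
    (by rw [← map_pow, hu.pow_eq_one, map_one]) fun j => ?_
  rw [← map_pow, torusMatrix_algebraMap, ← map_pow, ← Units.val_pow_eq_pow_val]
  exact isConj_torusMatrix_splitTorus _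

theorem sum_brauerCharacter_nonsplit {K : Type*} [Field K] [Finite K] [Algebra F K] [Algebra K κ]
    [IsScalarTower F K κ] [Fact (finrank F K = 2)] (hχ : ∀ x : κˣ, χ x = 1 → x = 1)
    (ρ : Representation F (SpecialLinearGroup (Fin 2) F) V) {ζ : K}
    (hζ : IsPrimitiveRoot ζ (Fintype.card F + 1)) :
    ∑ z ∈ Polynomial.nthRootsFinset (Fintype.card F + 1) (1 : κ),
        brauerCharacter χ ρ (torusMatrix F z)
      = (Fintype.card F + 1 : ℕ) * finrank κ (fixedVectors (extendScalars κ ρ)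
          (MulAction.stabilizer _ (eigenPoint ζ))) := by
  rw [stabilizer_eigenPoint hζ]
  refine sum_brauerCharacter_eq hχ ρ (Nat.succ_pos _)
    (hζ.map_of_injective (algebraMap K κ).injective) (torusMatrix_pow_card_add_one hζ) fun j => ?_
  rw [← map_pow, torusMatrix_algebraMap]
  exact isConj_torusMatrix_pow hζ j

end TorusSums

theorem exists_quadratic_subfield (F κ : Type*) [Field F] [Finite F] [Field κ] [Finite κ]
    [Algebra F κ] (hκ : Even (finrank F κ)) :
    ∃ (K : Type) (_ : Field K) (_ : Fintype K) (_ : Algebra F K) (_ : Algebra K κ),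
      IsScalarTower F K κ ∧ finrank F K = 2 := by
  let p := ringChar F
  have : Fact p.Prime := ⟨CharP.char_is_prime F p⟩
  let K := FiniteField.Extension F p 2
  have hK : finrank F K = 2 := FiniteField.finrank_extension F p 2
  obtain ⟨f⟩ := FiniteField.nonempty_algHom_of_finrank_dvd (F := F) (K := K) (L := κ)
    (by rw [hK]; exact hκ.two_dvd)
  let : Algebra K κ := f.toRingHom.toAlgebra
  exact ⟨K, inferInstance, Fintype.ofFinite K, inferInstance, inferInstance,
    IsScalarTower.of_algebraMap_eq fun x => (f.commutes x).symm, hK⟩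

end SLTwo

end

theorem mainTheorem1 {F κ V : Type*} [Field F] [Fintype F]
    [Field κ] [Fintype κ] [Algebra F κ] (hκ : Even (Module.finrank F κ))
    (α : κˣ) (hα : ∀ x : κˣ, x ∈ Subgroup.zpowers α)
    (ξ : ℂˣ) (hξ : IsPrimitiveRoot ξ (Nat.card κˣ))
    [AddCommGroup V] [Module F V] [Module.Finite F V]
    (ρ : Representation F (Matrix.SpecialLinearGroup (Fin 2) F) V) :
    (Module.finrank F (Representation.IntertwiningMap (SLTwo.steinberg F) ρ) : ℂ) =
      1 / 2 *
        (1 / ((Fintype.card F : ℂ) - 1) *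
            ∑ ζ ∈ Polynomial.nthRootsFinset (Fintype.card F - 1) (1 : κ),
              SLTwo.brauerCharacter (SLTwo.rootLift α hα ξ hξ) ρ (SLTwo.torusMatrix F ζ)
          - 1 / ((Fintype.card F : ℂ) + 1) *
            ∑ ζ ∈ Polynomial.nthRootsFinset (Fintype.card F + 1) (1 : κ),
              SLTwo.brauerCharacter (SLTwo.rootLift α hα ξ hξ) ρ (SLTwo.torusMatrix F ζ)) := by
  obtain ⟨K, _, _, _, _, _, hK⟩ := SLTwo.exists_quadratic_subfield F κ hκ
  have : Fact (Module.finrank F K = 2) := ⟨hK⟩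
  obtain ⟨ζ, hζ⟩ := SLTwo.exists_isPrimitiveRoot K (n := Fintype.card F + 1)
    ⟨Fintype.card F - 1, by rw [SLTwo.card_quadratic (F := F), ← Nat.sq_sub_sq, one_pow]⟩
  have hχ (x : κˣ) : SLTwo.rootLift α hα ξ hξ x = 1 → x = 1 := SLTwo.rootLift_eq_one
  rw [SLTwo.finrank_intertwiningMap_steinberg, SLTwo.sum_brauerCharacter_split hχ,
    SLTwo.sum_brauerCharacter_nonsplit hχ ρ hζ,
    SLTwo.finrank_fixedVectors_coordinatePoints_eq_eigenPoint_add _ hζ,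
    SLTwo.finrank_sumZeroMaps_extendScalars, Nat.cast_sub Fintype.card_pos]
  have h1 : (Fintype.card F : ℂ) - 1 ≠ 0 :=
    sub_ne_zero.2 (by exact_mod_cast (Fintype.one_lt_card (α := F)).ne')
  have h2 : (Fintype.card F : ℂ) + 1 ≠ 0 := Nat.cast_add_one_ne_zero _
  push_cast
  field_simp
  ring
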